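/- Let $T\ge 0$ and let $(\Omega,\mathcal F,\mathbb P,\{\mathcal F_t\}_{t\in[0,T]})$ be a complete filtered probability space satisfying the usual conditions. Let $W$ be a standard $\{\mathcal F_t\}$-Brownian motion, $b,\gamma:[0,T]\times\mathbb R\to\mathbb R$ measurable, $y_0\in\mathbb R$, and let $Y$ be a strong solution (continuous, and adapted to the augmented filtration of $W$) of $$dY_t=b(t,Y_t)\,dt+\gamma(t,Y_t)\,dW_t,\qquad Y_0=y_0,\qquad \mathbb E\Bigl[\int_0^T|b(t,Y_t)|\,dt+\int_0^T\gamma(t,Y_t)^2\,dt\Bigr]<\infty .$$ Let $\{\mathcal F^Y_t\}$ be the filtration generated by $Y$. Let $\lambda:[0,T]\times\mathbb R\to(0,\infty)$ be measurable, put $\lambda_t=\lambda(t,Y_t)$, and assume $\mathbb E[\int_0^T\lambda_s\,ds]<\infty$. Let $N$ be an $\{\mathcal F_t\}$-adapted counting process with $N_0=0$ such that, for all $0\le s\le t\le T$ and $k=0,1,\dots$, $$\mathbb P[N_t-N_s=k\mid\mathcal F^Y_T\vee\mathcal F_s]=\frac{\bigl(\int_s^t\lambda_r\,dr\bigr)^k}{k!}\,e^{-\int_s^t\lambda_r\,dr}.$$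 Let $Z_1,Z_2,\dots$ be i.i.d. strictly positive random variables, distributed like a random variable $Z$, the sequence being independent of the pair $(N,Y)$, and let $C_t=\sum_{i=1}^{N_t}Z_i$ be the cumulative claims. Assume that for some constants $\eta,R>0$ $$\mathbb E[e^{\eta Ze^{RT}}]<\infty,\quad \mathbb E[Ze^{\eta Ze^{RT}}]<\infty,\quad \mathbb E[Z^2e^{\eta Ze^{RT}}]<\infty,$$ $$\mathbb E\Bigl[e^{(\mathbb E[e^{\eta e^{RT}Z}]-1)\int_t^T\lambda_s\,ds}\,\Big|\,\mathcal F_t\Bigr]<\infty\quad\mathbb P\text{-a.s., for all }t\in[0,T].$$ Then for every $\{\mathcal F^Y_t\}$-predictable reinsurance strategy $\{u_t\}_{t\in[0,T]}$ (a process with values in $[0,1]$) and every $t\in[0,T]$, the random variables $\int_0^tu_s\,dC_s$, $Z$ and $\int_0^tu_s\lambda_s\,ds$ are square integrable, $\int_0^tu_s^2\lambda_s\,ds$ is integrable, and $$\operatorname{Var}\Bigl[\int_0^tu_s\,dC_s\Bigr]=\mathbb E[Z^2]\,\mathbb E\Bigl[\int_0^tu_s^2\lambda_s\,ds\Bigr]+\mathbb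 E[Z]^2\operatorname{Var}\Bigl[\int_0^tu_s\lambda_s\,ds\Bigr].$$ -/

import Mathlib

open MeasureTheory ProbabilityTheory Set Filter Topology
open scoped NNReal ENNReal

noncomputable section

namespace StochasticFactorModel

variable {Ω : Type*} {mΩ : MeasurableSpace Ω} {T : ℝ}

/-- Lebesgue measure `ds` on the time interval `[0,T]`. -/
def timeMeasure (T : ℝ) : Measure (Icc (0 : ℝ) T) :=
  Measure.comap Subtype.val volume

/-- The usual conditions: every `P`-null set (measurable or not) belongs to the initial
σ-algebra, and the filtration is right-continuous. -/
structure UsualConditions [Fact (0 ≤ T)] (𝓕 : Filtration (Icc (0 : ℝ) T) mΩ) (P : Measure Ω) :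
    Prop where
  complete : ∀ A : Set Ω, P A = 0 → MeasurableSet[𝓕 ⊥] A
  rightContinuous : 𝓕.IsRightContinuous

/-- `W` is a standard Brownian motion on `[0,T]` relative to the filtration `𝓕`. -/
structure IsBrownianMotion [Fact (0 ≤ T)] (𝓕 : Filtration (Icc (0 : ℝ) T) mΩ) (P : Measure Ω)
    (W : Icc (0 : ℝ) T → Ω → ℝ) : Prop where
  adapted : ∀ t, Measurable[𝓕 t] (W t)
  initial : ∀ᵐ ω ∂P, W ⊥ ω = 0
  continuous_paths : ∀ᵐ ω ∂P, Continuous fun t => W t ω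
  indep_increment : ∀ s t, s ≤ t →
    Indep (MeasurableSpace.comap (fun ω => W t ω - W s ω) inferInstance) (𝓕 s) P
  law_increment : ∀ s t : Icc (0 : ℝ) T, s ≤ t →
    HasLaw (fun ω => W t ω - W s ω) (gaussianReal 0 ((t : ℝ) - (s : ℝ)).toNNReal) P

/-- A simple predictable process `∑_{i < n} ξ_i 1_{(τ_i, τ_{i+1}]}` with deterministic times `τ_i`
and bounded, `𝓕 τ_i`-measurable coefficients `ξ_i`. -/
structure SimpleProcess (𝓕 : Filtration (Icc (0 : ℝ) T) mΩ) where
  n : ℕ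
  τ : ℕ → Icc (0 : ℝ) T
  ξ : ℕ → Ω → ℝ
  mono : Monotone τ
  meas : ∀ i, Measurable[𝓕 (τ i)] (ξ i)
  bounded : ∃ K : ℝ, ∀ i ω, |ξ i ω| ≤ K

/-- The value of a simple process. -/
def SimpleProcess.val {𝓕 : Filtration (Icc (0 : ℝ) T) mΩ} (H : SimpleProcess 𝓕)
    (s : Icc (0 : ℝ) T) (ω : Ω) : ℝ :=
  ∑ i ∈ Finset.range H.n, (Ioc (H.τ i) (H.τ (i + 1))).indicator (fun _ => H.ξ i ω) s

/-- The elementary stochastic integral `∫_0^t H dW` of a simple process. -/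
def SimpleProcess.integral {𝓕 : Filtration (Icc (0 : ℝ) T) mΩ} (H : SimpleProcess 𝓕)
    (W : Icc (0 : ℝ) T → Ω → ℝ) (t : Icc (0 : ℝ) T) (ω : Ω) : ℝ :=
  ∑ i ∈ Finset.range H.n, H.ξ i ω * (W (min (H.τ (i + 1)) t) ω - W (min (H.τ i) t) ω)

/-- `I` is (a continuous version of) the Itô integral process `t ↦ ∫_0^t H dW` of a process `H`
with `E ∫_0^T H² ds < ∞`: the `L²` limit of the elementary integrals of simple processes
that converge to `H` in `L²(dP ⊗ ds)`. -/
structure IsItoIntegral (𝓕 : Filtration (Icc (0 : ℝ) T) mΩ) (P : Measure Ω)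
    (W H I : Icc (0 : ℝ) T → Ω → ℝ) : Prop where
  adapted : ∀ t, Measurable[𝓕 t] (I t)
  continuous_paths : ∀ᵐ ω ∂P, Continuous fun t => I t ω
  limit : ∃ S : ℕ → SimpleProcess 𝓕,
    Tendsto (fun n => ∫⁻ ω, ∫⁻ s, ENNReal.ofReal (((S n).val s ω - H s ω) ^ 2)
      ∂(timeMeasure T) ∂P) atTop (𝓝 0) ∧
    ∀ t, Tendsto (fun n => ∫⁻ ω, ENNReal.ofReal (((S n).integral W t ω - I t ω) ^ 2) ∂P)
      atTop (𝓝 0)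

/-- The σ-algebra generated by `W s`, `s ≤ t`, and all `P`-null sets. -/
abbrev augmentedHistory (P : Measure Ω) (W : Icc (0 : ℝ) T → Ω → ℝ) (t : Icc (0 : ℝ) T) :
    MeasurableSpace Ω :=
  (⨆ s ≤ t, MeasurableSpace.comap (W s) inferInstance) ⊔
    MeasurableSpace.generateFrom {A : Set Ω | P A = 0}

/-- `Y` is a strong solution on `[0,T]` of `dY = b(t,Y) dt + γ(t,Y) dW`, `Y_0 = y₀`, with
`E[∫_0^T |b(t,Y_t)| dt + ∫_0^T γ(t,Y_t)² dt] < ∞`: it is adapted to the augmented filtration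
of `W`, has continuous paths, and satisfies the integral equation. -/
structure IsStrongSolution [Fact (0 ≤ T)] (𝓕 : Filtration (Icc (0 : ℝ) T) mΩ) (P : Measure Ω)
    (W : Icc (0 : ℝ) T → Ω → ℝ) (b γ : Icc (0 : ℝ) T → ℝ → ℝ) (y₀ : ℝ)
    (Y : Icc (0 : ℝ) T → Ω → ℝ) : Prop where
  adapted : ∀ t, Measurable[augmentedHistory P W t] (Y t)
  continuous_paths : ∀ᵐ ω ∂P, Continuous fun t => Y t ω
  integrable_coeff : ∫⁻ ω, ((∫⁻ s, ENNReal.ofReal |b s (Y s ω)| ∂(timeMeasure T)) +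
    ∫⁻ s, ENNReal.ofReal (γ s (Y s ω) ^ 2) ∂(timeMeasure T)) ∂P < ∞
  equation : ∃ I, IsItoIntegral 𝓕 P W (fun s ω => γ s (Y s ω)) I ∧
    ∀ᵐ ω ∂P, ∀ t, Y t ω = y₀ + (∫ s in Iic t, b s (Y s ω) ∂(timeMeasure T)) + I t ω

/-- The filtration `𝓕^Y` generated by the process `Y`. -/
def generatedFiltration (Y : Icc (0 : ℝ) T → Ω → ℝ) (hY : ∀ t, Measurable (Y t)) :
    Filtration (Icc (0 : ℝ) T) mΩ :=
  Filtration.natural Y fun t => (hY t).stronglyMeasurable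

/-- `N` is an `𝓕`-adapted counting process which, conditionally on `Y`, is a Poisson process with
intensity `lam`: for `s ≤ t` and `k ∈ ℕ`,
`P[N_t - N_s = k | 𝓕^Y_T ∨ 𝓕_s] = (∫_s^t lam)^k / k! * exp (-∫_s^t lam)`. -/
structure IsConditionalPoisson [Fact (0 ≤ T)] (𝓕 : Filtration (Icc (0 : ℝ) T) mΩ) (P : Measure Ω)
    (Y : Icc (0 : ℝ) T → Ω → ℝ) (hY : ∀ t, Measurable (Y t))
    (lam : Icc (0 : ℝ) T → Ω → ℝ) (N : Icc (0 : ℝ) T → Ω → ℕ) : Prop where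
  adapted : ∀ t, Measurable[𝓕 t] (N t)
  initial : ∀ᵐ ω ∂P, N ⊥ ω = 0
  monotone_paths : ∀ᵐ ω ∂P, Monotone fun t => N t ω
  rightContinuous_paths : ∀ᵐ ω ∂P, ∀ t, ContinuousWithinAt (fun r => N r ω) (Ici t) t
  conditional_law : ∀ s t, s ≤ t → ∀ k : ℕ,
    P[{ω | N t ω = N s ω + k}.indicator (fun _ => (1 : ℝ)) |
        generatedFiltration Y hY ⊤ ⊔ 𝓕 s]
      =ᵐ[P] fun ω => (∫ r in Ioc s t, lam r ω ∂(timeMeasure T)) ^ k / (k.factorial : ℝ) *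
        Real.exp (-∫ r in Ioc s t, lam r ω ∂(timeMeasure T))

/-- The claim sizes `ζ 0, ζ 1, …` are i.i.d. copies of `Z`, strictly positive, and
(as a sequence) independent of the pair of processes `(N, Y)`. -/
structure IsClaimSequence (P : Measure Ω) (Y : Icc (0 : ℝ) T → Ω → ℝ)
    (N : Icc (0 : ℝ) T → Ω → ℕ) (ζ : ℕ → Ω → ℝ) (Z : Ω → ℝ) : Prop where
  measurable : ∀ i, Measurable (ζ i)
  positive : ∀ i, ∀ᵐ ω ∂P, 0 < ζ i ω
  iIndep : iIndepFun ζ P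
  identDistrib : ∀ i, IdentDistrib (ζ i) Z P P
  indep_arrivals_factor :
    Indep (⨆ i, MeasurableSpace.comap (ζ i) inferInstance)
      ((⨆ t, MeasurableSpace.comap (N t) inferInstance) ⊔
        ⨆ t, MeasurableSpace.comap (Y t) inferInstance) P

/-- The exponential integrability assumptions on claim sizes and intensity, for a risk aversion
parameter `η` and an interest rate `R`. The conditional expectation is that of a nonnegative,
possibly nonintegrable, random variable. -/
structure ExponentialIntegrability [Fact (0 ≤ T)] (𝓕 : Filtration (Icc (0 : ℝ) T) mΩ)
    (P : Measure Ω) (η R : ℝ) (Z : Ω → ℝ) (lam : Icc (0 : ℝ) T → Ω → ℝ) : Prop where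
  exp_claim : Integrable (fun ω => Real.exp (η * Z ω * Real.exp (R * T))) P
  mul_exp_claim : Integrable (fun ω => Z ω * Real.exp (η * Z ω * Real.exp (R * T))) P
  sq_mul_exp_claim : Integrable (fun ω => Z ω ^ 2 * Real.exp (η * Z ω * Real.exp (R * T))) P
  exp_intensity : ∀ t, ∀ᵐ ω ∂P,
    condLExp (𝓕 t) P (fun ω' => ENNReal.ofReal (Real.exp
      (((∫ ω'', Real.exp (η * Real.exp (R * T) * Z ω'') ∂P) - 1) *
        ∫ s in Ioc t ⊤, lam s ω' ∂(timeMeasure T)))) ω < ∞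

/-- The cumulative claims `C_t = ∑_{i ≤ N_t} Z_i` (the `i`-th claim is `ζ (i - 1)`). -/
def cumulativeClaims (N : Icc (0 : ℝ) T → Ω → ℕ) (ζ : ℕ → Ω → ℝ) (t : Icc (0 : ℝ) T) (ω : Ω) : ℝ :=
  ∑ i ∈ Finset.range (N t ω), ζ i ω

open scoped Classical in
/-- The Lebesgue-Stieltjes measure `df` on `[0,T]` of a nondecreasing right-continuous function,
with `df (s,t] = f t - f s` and no mass at `0`. -/
def stieltjesMeasure [Fact (0 ≤ T)] (f : Icc (0 : ℝ) T → ℝ) : Measure (Icc (0 : ℝ) T) :=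
  if h : Monotone f ∧ ∀ x, ContinuousWithinAt f (Ici x) x then
    (StieltjesFunction.mk f h.1 h.2).measure
  else 0

/-- The pathwise Lebesgue-Stieltjes integral `∫_0^t u_s dC_s`. -/
def pathIntegral [Fact (0 ≤ T)] (u C : Icc (0 : ℝ) T → Ω → ℝ) (t : Icc (0 : ℝ) T) (ω : Ω) : ℝ :=
  ∫ s in Iic t, u s ω ∂(stieltjesMeasure fun r => C r ω)

end StochasticFactorModel

end

/-!
The claims process jumps only at the arrival times `τ₀ ≤ τ₁ ≤ …` of `N`, so on almost every path
`∫₀ᵗ u dC = ∑_{i < N t} u(τᵢ) ζᵢ` (`stieltjesMeasure_sum_range`). The weights `u(τᵢ)` are functions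
of `(N, Y)`, of which the i.i.d. claims are independent; expanding the square gives
`E[∫ u dC] = E[Z] E[∫ u dN]` and
`E[(∫ u dC)²] = (E[Z²] - E[Z]²) E[∫ u² dN] + E[Z]² E[(∫ u dN)²]` (`lintegral_tsum_mul_of_indep`,
`lintegral_tsum_mul_sq_of_indep`).

It remains to compute the moments of integrals against `dN`. As `u` is predictable for the
filtration of `Y`, it is known given `Y`, and only the conditional Poisson law of `N` matters. With
`Λ t = ∫₀ᵗ λ ds`, that law gives, on every event `A` determined by `Y` and for `s ≤ t`,
`E[N t; A] = E[Λ t; A]` and `E[N s N t; A] = E[Λ s Λ t + Λ s; A]`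
(`setLIntegral_natCast_of_hasConditionalPoissonLaw`). These identities say that the mean measures
of the points `(τᵢ, ω)` and `((τᵢ, τⱼ), ω)` agree with explicit measures on a π-system of
rectangles, hence everywhere. Integrating `u` and `u ⊗ u` yields the Campbell formulas
`E[∫ u dN] = E[∫ u λ ds]` and `E[(∫ u dN)²] = E[(∫ u λ ds)²] + E[∫ u² λ ds]`
(`lintegral_tsum_jumps`, `lintegral_tsum_jumps_sq`), from which the variance formula follows.

Everything is finite once `Λ T` is square integrable. The exponential moment of `Λ T` is assumed
only conditionally on the initial σ-algebra, which need not be trivial. But `Y` is adapted to the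
augmented filtration of the Brownian motion `W`, which is independent of the initial σ-algebra
(`IsBrownianMotion.indep_augmentedHistory`), so the conditional expectation at time `0` is the
unconditional one; its exponent has a positive factor because the claims are positive
(`lintegral_sq_intensity_ne_top`).

Moments are computed in `[0, ∞]`, where no integrability has to be checked beforehand. Path
properties hold only almost surely, so `N` and `Y` are replaced by regular versions and all
σ-algebras are completed by null sets (`eventuallyMeasurableSpace`).
-/

noncomputable section

namespace StochasticFactorModel

/-! ### Independence and null sets -/

section Independence

variable {Ω : Type*} {m₁ m₂ m₃ mΩ : MeasurableSpace Ω} {μ : Measure Ω}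

/-- If `m₂` is independent of the join of `m₁` and `m₃`, and `m₁` is independent of `m₃`, then
`m₁ ⊔ m₂` is independent of `m₃`. -/
lemma indep_sup_left_of_indep_sup_right [IsProbabilityMeasure μ] (h₁ : m₁ ≤ mΩ) (h₂ : m₂ ≤ mΩ)
    (h₃ : m₃ ≤ mΩ) (h₁₃ : Indep m₁ m₃ μ) (h : Indep m₂ (m₁ ⊔ m₃) μ) :
    Indep (m₁ ⊔ m₂) m₃ μ := by
  set p : Set (Set Ω) := image2 (· ∩ ·) {s | MeasurableSet[m₁] s} {s | MeasurableSet[m₂] s}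
  refine IndepSets.indep (p1 := p) (p2 := {s | MeasurableSet[m₃] s}) (sup_le h₁ h₂) h₃ ?_
    (@MeasurableSpace.isPiSystem_measurableSet Ω m₃) ?_
    (@MeasurableSpace.generateFrom_measurableSet Ω m₃).symm ?_
  · rintro _ ⟨A, hA, B, hB, rfl⟩ _ ⟨A', hA', B', hB', rfl⟩ -
    exact ⟨A ∩ A', MeasurableSet.inter hA hA', B ∩ B', MeasurableSet.inter hB hB',
      (inter_inter_inter_comm ..).symm⟩
  · refine le_antisymm (sup_le ?_ ?_) (MeasurableSpace.generateFrom_le ?_)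
    · exact fun A hA => MeasurableSpace.measurableSet_generateFrom
        ⟨A, hA, univ, MeasurableSet.univ, inter_univ A⟩
    · exact fun B hB => MeasurableSpace.measurableSet_generateFrom
        ⟨univ, MeasurableSet.univ, B, hB, univ_inter B⟩
    · rintro _ ⟨A, hA, B, hB, rfl⟩
      exact MeasurableSet.inter ((le_sup_left : m₁ ≤ m₁ ⊔ m₂) _ hA)
        ((le_sup_right : m₂ ≤ m₁ ⊔ m₂) _ hB)
  · rw [IndepSets_iff]
    rintro _ C ⟨A, hA, B, hB, rfl⟩ hC
    rw [Indep_iff] at h h₁₃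
    have hAC : MeasurableSet[m₁ ⊔ m₃] (A ∩ C) :=
      MeasurableSet.inter ((le_sup_left : m₁ ≤ m₁ ⊔ m₃) _ hA)
        ((le_sup_right : m₃ ≤ m₁ ⊔ m₃) _ hC)
    have e₁ := h B (A ∩ C) hB hAC
    have e₂ := h B A hB ((le_sup_left : m₁ ≤ m₁ ⊔ m₃) _ hA)
    change μ (A ∩ B ∩ C) = μ (A ∩ B) * μ C
    rw [show A ∩ B ∩ C = B ∩ (A ∩ C) by rw [inter_comm A B, inter_assoc], e₁, h₁₃ A C hA hC,
      inter_comm A B, e₂, mul_assoc]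

/-- Completing a σ-algebra by null sets preserves independence. -/
lemma indep_eventuallyMeasurableSpace_right (h : Indep m₁ m₂ μ) :
    Indep m₁ (eventuallyMeasurableSpace m₂ (ae μ)) μ := by
  rw [Indep_iff] at h ⊢
  rintro A B hA ⟨B', hB', hBB'⟩
  rw [measure_congr hBB', ← h A B' hA hB']
  exact measure_congr ((EventuallyEq.refl _ A).inter hBB')

/-- In a complete σ-algebra the completion of a sub-σ-algebra adds nothing new. -/
lemma eventuallyMeasurableSpace_le (h : m₁ ≤ m₂)
    (hnull : ∀ A : Set Ω, μ A = 0 → MeasurableSet[m₂] A) :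
    eventuallyMeasurableSpace m₁ (ae μ) ≤ m₂ := by
  rintro A ⟨B, hB, hAB⟩
  obtain ⟨h₁, h₂⟩ := ae_eq_set.1 hAB
  have : A = (B \ (B \ A)) ∪ (A \ B) := by grind
  rw [this]
  exact ((h _ hB).diff (hnull _ h₂)).union (hnull _ h₁)

lemma generateFrom_null_le_eventuallyMeasurableSpace :
    MeasurableSpace.generateFrom {A : Set Ω | μ A = 0} ≤
      eventuallyMeasurableSpace m₁ (ae μ) := by
  refine MeasurableSpace.generateFrom_le fun A hA => ⟨∅, @MeasurableSet.empty Ω m₁, ?_⟩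
  exact ae_eq_empty.2 hA

end Independence

/-! ### Brownian motion and the initial σ-algebra -/

section Brownian

variable {Ω : Type*} {mΩ : MeasurableSpace Ω} {T : ℝ} [Fact (0 ≤ T)]
  {𝓕 : Filtration (Icc (0 : ℝ) T) mΩ} {P : Measure Ω}
  {W : Icc (0 : ℝ) T → Ω → ℝ}

lemma IsBrownianMotion.measurable (hW : IsBrownianMotion 𝓕 P W) (t : Icc (0 : ℝ) T) :
    Measurable (W t) :=
  (hW.adapted t).mono (𝓕.le t) le_rfl

/-- Finitely many values of a Brownian motion are independent of the initial σ-algebra: the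
increment to a new largest time is independent of everything before it. -/
lemma IsBrownianMotion.indep_finset [IsProbabilityMeasure P] (hW : IsBrownianMotion 𝓕 P W)
    (S : Finset (Icc (0 : ℝ) T)) :
    Indep (⨆ s ∈ insert ⊥ S, MeasurableSpace.comap (W s) inferInstance) (𝓕 ⊥) P := by
  classical
  induction S using Finset.induction_on_max with
  | empty =>
    -- `W ⊥` is almost surely constant
    have h0 : Indep (MeasurableSpace.comap (fun _ : Ω => (0 : ℝ)) inferInstance) (𝓕 ⊥) P := by
      rw [MeasurableSpace.comap_const]
      exact indep_bot_left _
    have h1 : Indep (MeasurableSpace.comap (W ⊥) inferInstance) (𝓕 ⊥) P := by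
      rw [Indep_iff] at h0 ⊢
      rintro _ B ⟨A, hA, rfl⟩ hB
      have hae : W ⊥ ⁻¹' A =ᵐ[P] (fun _ : Ω => (0 : ℝ)) ⁻¹' A :=
        Filter.EventuallyEq.preimage (f := W ⊥) (g := fun _ => (0 : ℝ)) hW.initial A
      rw [measure_congr hae, ← h0 _ B ⟨A, hA, rfl⟩ hB]
      exact measure_congr (hae.inter (EventuallyEq.refl _ B))
    simpa using h1
  | insert t S hlt ih =>
    have hle : ∀ s, MeasurableSpace.comap (W s) inferInstance ≤ mΩ := fun s =>
      (hW.measurable s).comap_le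
    set S' := insert ⊥ S
    have hne : S'.Nonempty := ⟨⊥, by simp [S']⟩
    set r := S'.max' hne
    have hrt : r ≤ t := by
      refine Finset.max'_le _ _ _ fun s hs => ?_
      rcases Finset.mem_insert.1 hs with rfl | hs
      · exact bot_le
      · exact (hlt s hs).le
    set m₁ : MeasurableSpace Ω := ⨆ s ∈ S', MeasurableSpace.comap (W s) inferInstance
    set m₂ : MeasurableSpace Ω :=
      MeasurableSpace.comap (fun ω => W t ω - W r ω) inferInstance
    have hm₁r : m₁ ≤ 𝓕 r := iSup₂_le fun s hs =>
      ((hW.adapted s).mono (𝓕.mono (S'.le_max' s hs)) le_rfl).comap_le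
    have hrm₁ : Measurable[m₁] (W r) := by
      rw [measurable_iff_comap_le]
      exact le_iSup₂_of_le r (S'.max'_mem hne) le_rfl
    -- `W t` is the sum of `W r`, at the latest earlier time `r`, and the increment from `r` to `t`
    have hind : Indep (m₁ ⊔ m₂) (𝓕 ⊥) P := by
      refine indep_sup_left_of_indep_sup_right (iSup₂_le fun s _ => hle s)
        ((hW.measurable t).sub (hW.measurable r)).comap_le (𝓕.le ⊥) ih ?_
      exact indep_of_indep_of_le_right (hW.indep_increment r t hrt)
        (sup_le hm₁r (𝓕.mono bot_le))
    refine indep_of_indep_of_le_left hind (iSup₂_le fun s hs => ?_)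
    rw [Finset.insert_comm] at hs
    rcases Finset.mem_insert.1 hs with rfl | hs
    · rw [← measurable_iff_comap_le]
      have h₂ : Measurable[m₁ ⊔ m₂] (fun ω => W s ω - W r ω) :=
        (comap_measurable (fun ω => W s ω - W r ω)).mono le_sup_right le_rfl
      have h₁ : Measurable[m₁ ⊔ m₂] (W r) := hrm₁.mono le_sup_left le_rfl
      convert h₂.add h₁ using 1
      ext ω
      simp
    · exact le_sup_of_le_left (le_iSup₂_of_le s hs le_rfl)

/-- A Brownian motion, with the null sets adjoined, is independent of the initial σ-algebra. -/
lemma IsBrownianMotion.indep_augmentedHistory [IsProbabilityMeasure P] (hW : IsBrownianMotion 𝓕 P W)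
    (t : Icc (0 : ℝ) T) :
    Indep (𝓕 ⊥) (augmentedHistory P W t) P := by
  classical
  have hle : ∀ s, MeasurableSpace.comap (W s) inferInstance ≤ mΩ := fun s =>
    (hW.measurable s).comap_le
  have h : Indep (⨆ S : Finset (Icc (0 : ℝ) T),
      ⨆ s ∈ insert ⊥ S, MeasurableSpace.comap (W s) inferInstance) (𝓕 ⊥) P := by
    refine indep_iSup_of_directed_le hW.indep_finset (fun S => iSup₂_le fun s _ => hle s)
      (𝓕.le ⊥) (Monotone.directed_le fun S S' hS => ?_)
    exact biSup_mono fun s hs => Finset.insert_subset_insert _ hS hs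
  refine indep_of_indep_of_le_right (indep_eventuallyMeasurableSpace_right h.symm)
    (sup_le ?_ generateFrom_null_le_eventuallyMeasurableSpace)
  refine le_trans (iSup₂_le fun s _ => ?_) le_eventuallyMeasurableSpace
  exact le_iSup_of_le {s} (le_iSup₂_of_le s (by simp) le_rfl)

end Brownian

/-! ### Integrability from conditional integrability -/

/-- A random variable that is independent of the conditioning σ-algebra and has an almost surely
finite conditional expectation has a finite expectation. -/
lemma lintegral_ne_top_of_condLExp_lt_top {Ω : Type*} {m m' mΩ : MeasurableSpace Ω}
    {P : Measure Ω} [IsProbabilityMeasure P] (hm : m ≤ mΩ) (hm' : m' ≤ mΩ) {f : Ω → ℝ≥0∞}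
    (hf : Measurable[m'] f) (hind : Indep m m' P)
    (hfin : ∀ᵐ ω ∂P, condLExp m P f ω < ∞) : ∫⁻ ω, f ω ∂P ≠ ∞ := by
  set g := condLExp m P f
  have hg : Measurable[m] g := measurable_condLExp m P f
  set A : ℕ → Set Ω := fun n => {ω | g ω ≤ n}
  have hA : ∀ n, MeasurableSet[m] (A n) := fun n => hg measurableSet_Iic
  have hcover : P (⋃ n, A n) = 1 := by
    rw [prob_compl_eq_zero_iff (MeasurableSet.iUnion fun n => hm _ (hA n)) |>.symm]
    refine measure_mono_null (fun ω hω => ?_) hfin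
    intro hlt
    obtain ⟨n, hn⟩ := ENNReal.exists_nat_gt hlt.ne
    exact hω (mem_iUnion.2 ⟨n, hn.le⟩)
  obtain ⟨n, hn⟩ : ∃ n, P (A n) ≠ 0 := by
    by_contra! h
    rw [measure_iUnion_null h] at hcover
    exact zero_ne_one hcover
  -- on `A n` the conditional expectation is bounded, while by independence the integral over
  -- `A n` is a positive multiple of the full one
  have h1 : ∫⁻ ω in A n, f ω ∂P = P (A n) * ∫⁻ ω, f ω ∂P := by
    have hi : Measurable[m] ((A n).indicator (fun _ => (1 : ℝ≥0∞))) :=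
      Measurable.indicator measurable_const (hA n)
    have := lintegral_mul_eq_lintegral_mul_lintegral_of_independent_measurableSpace hm hm' hind
      hi hf
    rw [lintegral_indicator_const (hm _ (hA n)), one_mul] at this
    rw [← this, ← lintegral_indicator (hm _ (hA n))]
    refine lintegral_congr fun ω => ?_
    by_cases h : ω ∈ A n <;> simp [h]
  have h2 : ∫⁻ ω in A n, f ω ∂P ≤ n := by
    rw [← setLIntegral_condLExp hm P f (hA n)]
    calc ∫⁻ ω in A n, g ω ∂P ≤ ∫⁻ _ in A n, (n : ℝ≥0∞) ∂P :=
          setLIntegral_mono measurable_const fun ω hω => hω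
      _ ≤ n := by
          rw [setLIntegral_const]
          exact mul_le_of_le_one_right' prob_le_one
  intro htop
  rw [h1, htop, ENNReal.mul_top hn] at h2
  exact absurd h2 (by simp)

/-! ### Moments of a conditionally Poisson variable -/

lemma tsum_poisson {r : ℝ} (hr : 0 ≤ r) :
    ∑' k : ℕ, ENNReal.ofReal (r ^ k / (k.factorial : ℝ) * Real.exp (-r)) = 1 := by
  have h := hasSum_one_poissonMeasure ⟨r, hr⟩
  have h' : HasSum (fun k : ℕ => r ^ k / (k.factorial : ℝ) * Real.exp (-r)) 1 := by
    convert h using 2 with k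
    change _ = Real.exp (-r) * r ^ k / _
    ring
  rw [← ENNReal.ofReal_tsum_of_nonneg (fun k => by positivity) h'.summable, h'.tsum_eq,
    ENNReal.ofReal_one]

/-- The Poisson weights satisfy `(k + 1) p (k + 1) = r p k`. -/
lemma succ_mul_poisson {r : ℝ} (hr : 0 ≤ r) (k : ℕ) :
    ((k + 1 : ℕ) : ℝ≥0∞) *
        ENNReal.ofReal (r ^ (k + 1) / ((k + 1).factorial : ℝ) * Real.exp (-r)) =
      ENNReal.ofReal r * ENNReal.ofReal (r ^ k / (k.factorial : ℝ) * Real.exp (-r)) := by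
  rw [← ENNReal.ofReal_natCast, ← ENNReal.ofReal_mul (by positivity), ← ENNReal.ofReal_mul hr]
  congr 1
  rw [Nat.factorial_succ]
  push_cast
  have : (k.factorial : ℝ) ≠ 0 := by positivity
  have : (k : ℝ) + 1 ≠ 0 := by positivity
  field_simp
  ring

lemma tsum_mul_poisson {r : ℝ} (hr : 0 ≤ r) :
    ∑' k : ℕ, (k : ℝ≥0∞) * ENNReal.ofReal (r ^ k / (k.factorial : ℝ) * Real.exp (-r)) =
      ENNReal.ofReal r := by
  rw [tsum_eq_zero_add' ENNReal.summable]
  simp_rw [succ_mul_poisson hr, ENNReal.tsum_mul_left, tsum_poisson hr]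
  simp

lemma tsum_sq_mul_poisson {r : ℝ} (hr : 0 ≤ r) :
    ∑' k : ℕ, (k : ℝ≥0∞) ^ 2 * ENNReal.ofReal (r ^ k / (k.factorial : ℝ) * Real.exp (-r)) =
      ENNReal.ofReal r ^ 2 + ENNReal.ofReal r := by
  rw [tsum_eq_zero_add' ENNReal.summable]
  simp_rw [pow_two, mul_assoc, succ_mul_poisson hr]
  have : ∀ k : ℕ, ((k + 1 : ℕ) : ℝ≥0∞) * (ENNReal.ofReal r *
        ENNReal.ofReal (r ^ k / (k.factorial : ℝ) * Real.exp (-r))) =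
      ENNReal.ofReal r * ((k : ℝ≥0∞) *
          ENNReal.ofReal (r ^ k / (k.factorial : ℝ) * Real.exp (-r)) +
        ENNReal.ofReal (r ^ k / (k.factorial : ℝ) * Real.exp (-r))) := by
    intro k
    push_cast
    ring
  simp_rw [this, ENNReal.tsum_mul_left, ENNReal.tsum_add, tsum_mul_poisson hr, tsum_poisson hr]
  simp [mul_add]

section ConditionalPoisson

variable {Ω : Type*} {m mΩ : MeasurableSpace Ω} {P : Measure Ω} [IsProbabilityMeasure P]

/-- `K` has, conditionally on `m`, the Poisson distribution with parameter `L`. -/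
def HasConditionalPoissonLaw (P : Measure Ω) (m : MeasurableSpace Ω) (K : Ω → ℕ) (L : Ω → ℝ) :
    Prop :=
  ∀ k : ℕ, P[{ω | K ω = k}.indicator (fun _ => (1 : ℝ)) | m]
    =ᵐ[P] fun ω => L ω ^ k / (k.factorial : ℝ) * Real.exp (-L ω)

variable {K : Ω → ℕ} {L : Ω → ℝ}

lemma HasConditionalPoissonLaw.measure_inter (h : HasConditionalPoissonLaw P m K L) (hm : m ≤ mΩ)
    (hK : Measurable K) {A : Set Ω} (hA : MeasurableSet[m] A) (k : ℕ) :
    P (A ∩ {ω | K ω = k}) =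
      ∫⁻ ω in A, ENNReal.ofReal (L ω ^ k / (k.factorial : ℝ) * Real.exp (-L ω)) ∂P := by
  have hKk : MeasurableSet {ω | K ω = k} := hK (measurableSet_singleton k)
  have h1 : condLExp m P (fun ω => ENNReal.ofReal
        ({ω | K ω = k}.indicator (fun _ => (1 : ℝ)) ω)) =ᵐ[P]
      fun ω => ENNReal.ofReal (L ω ^ k / (k.factorial : ℝ) * Real.exp (-L ω)) := by
    refine (condLExp_ofReal m ((integrable_const 1).indicator hKk)
      (.of_forall fun ω => indicator_nonneg (fun _ _ => zero_le_one) ω)).trans ?_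
    filter_upwards [h k] with ω hω
    rw [hω]
  rw [← lintegral_congr_ae (ae_restrict_of_ae h1), setLIntegral_condLExp hm P _ hA]
  have : (fun ω => ENNReal.ofReal ({ω | K ω = k}.indicator (fun _ => (1 : ℝ)) ω)) =
      {ω | K ω = k}.indicator (fun _ => 1) := by
    ext ω
    by_cases hω : K ω = k <;> simp [hω]
  rw [this, lintegral_indicator_const hKk, one_mul, Measure.restrict_apply hKk, inter_comm]

/-- Conditional expectation of a function of a conditionally Poisson variable. -/
lemma HasConditionalPoissonLaw.setLIntegral (h : HasConditionalPoissonLaw P m K L) (hm : m ≤ mΩ)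
    (hK : Measurable K) (hL : AEMeasurable L P) {A : Set Ω} (hA : MeasurableSet[m] A)
    (φ : ℕ → ℝ≥0∞) :
    ∫⁻ ω in A, φ (K ω) ∂P = ∫⁻ ω in A, ∑' k : ℕ, φ k *
      ENNReal.ofReal (L ω ^ k / (k.factorial : ℝ) * Real.exp (-L ω)) ∂P := by
  have hsum : ∀ ω, φ (K ω) = ∑' k : ℕ, φ k * {ω | K ω = k}.indicator (fun _ => 1) ω := by
    intro ω
    rw [tsum_eq_single (K ω) (fun k hk => by simp [hk.symm])]
    simp
  have hKk : ∀ k, MeasurableSet {ω | K ω = k} := fun k => hK (measurableSet_singleton k)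
  simp_rw [hsum]
  rw [lintegral_tsum fun k => ((measurable_const.indicator (hKk k)).const_mul _).aemeasurable,
    lintegral_tsum fun k => ?_]
  · refine tsum_congr fun k => ?_
    rw [lintegral_const_mul _ (measurable_const.indicator (hKk k)), lintegral_const_mul'',
      ← h.measure_inter hm hK hA, lintegral_indicator_const (hKk k), one_mul,
      Measure.restrict_apply (hKk k), inter_comm]
    have := hL.restrict (s := A)
    fun_prop
  · have := hL.restrict (s := A)
    fun_prop

omit [IsProbabilityMeasure P] in
/-- Replacing one density by another with the same integrals over `m`-measurable sets. -/
lemma lintegral_mul_eq_of_setLIntegral_eq (hm : m ≤ mΩ) {f g : Ω → ℝ≥0∞}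
    (hf : AEMeasurable f P) (hg : AEMeasurable g P)
    (h : ∀ A, MeasurableSet[m] A → ∫⁻ ω in A, f ω ∂P = ∫⁻ ω in A, g ω ∂P)
    {φ : Ω → ℝ≥0∞} (hφ : Measurable[m] φ) :
    ∫⁻ ω, φ ω * f ω ∂P = ∫⁻ ω, φ ω * g ω ∂P := by
  have key : (P.withDensity f).trim hm = (P.withDensity g).trim hm := by
    refine @Measure.ext _ m _ _ fun A hA => ?_
    rw [trim_measurableSet_eq hm hA, trim_measurableSet_eq hm hA, withDensity_apply _ (hm A hA),
      withDensity_apply _ (hm A hA), h A hA]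
  have hφ' : AEMeasurable φ P := (hφ.mono hm le_rfl).aemeasurable
  have e : ∀ {k : Ω → ℝ≥0∞}, AEMeasurable k P →
      ∫⁻ ω, φ ω * k ω ∂P = ∫⁻ ω, φ ω ∂(P.withDensity k).trim hm := by
    intro k hk
    rw [lintegral_trim hm hφ,
      lintegral_withDensity_eq_lintegral_mul₀' hk
        (hφ'.mono_ac (withDensity_absolutelyContinuous _ _))]
    simp only [Pi.mul_apply, mul_comm]
  rw [e hf, e hg, key]

end ConditionalPoisson

section CoxMoments

variable {Ω I : Type*} {mΩ : MeasurableSpace Ω} {P : Measure Ω} [IsProbabilityMeasure P]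
  [LinearOrder I] [OrderBot I]

/-- First and second moments of a process `N` that, given the past `G s`, has increments over
`(s, t]` with the Poisson distribution of parameter `D s t`, where the additive `D` is known at
time `⊥`. -/
lemma setLIntegral_natCast_of_hasConditionalPoissonLaw {G : I → MeasurableSpace Ω}
    (hG : ∀ s, G s ≤ mΩ) (hGmono : Monotone G) {N : I → Ω → ℕ} (hN : ∀ s, Measurable[G s] (N s))
    (hN0 : ∀ ω, N ⊥ ω = 0) (hNmono : ∀ ω, Monotone fun t => N t ω)
    {L : I → I → Ω → ℝ} {D : I → I → Ω → ℝ≥0∞} (hL0 : ∀ s t ω, 0 ≤ L s t ω)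
    (hLD : ∀ s t, (fun ω => ENNReal.ofReal (L s t ω)) =ᵐ[P] D s t)
    (hL : ∀ s t, AEMeasurable (L s t) P)
    (hD : ∀ s t, Measurable[G ⊥] (D s t))
    (hDadd : ∀ s t, s ≤ t → ∀ ω, D ⊥ t ω = D ⊥ s ω + D s t ω)
    (hlaw : ∀ s t, s ≤ t → HasConditionalPoissonLaw P (G s) (fun ω => N t ω - N s ω) (L s t))
    {A : Set Ω} (hA : MeasurableSet[G ⊥] A) :
    (∀ t, ∫⁻ ω in A, (N t ω : ℝ≥0∞) ∂P = ∫⁻ ω in A, D ⊥ t ω ∂P) ∧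
    ∀ s t, s ≤ t → ∫⁻ ω in A, (N s ω : ℝ≥0∞) * N t ω ∂P =
      ∫⁻ ω in A, (D ⊥ s ω * D ⊥ t ω + D ⊥ s ω) ∂P := by
  have hNm : ∀ s, Measurable (N s) := fun s => (hN s).mono (hG s) le_rfl
  have hNE : ∀ s, Measurable fun ω => (N s ω : ℝ≥0∞) := fun s =>
    measurable_from_top.comp (hNm s)
  have hDm : ∀ s t, Measurable (D s t) := fun s t => (hD s t).mono (hG ⊥) le_rfl
  have hKm : ∀ s t, Measurable fun ω => N t ω - N s ω := fun s t => (hNm t).sub (hNm s)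
  -- the conditional mean of an increment
  have hfst : ∀ s t, s ≤ t → ∀ B, MeasurableSet[G s] B →
      ∫⁻ ω in B, ((N t ω - N s ω : ℕ) : ℝ≥0∞) ∂P = ∫⁻ ω in B, D s t ω ∂P := by
    intro s t hst B hB
    rw [(hlaw s t hst).setLIntegral (hG s) (hKm s t) (hL s t) hB (fun k => (k : ℝ≥0∞))]
    simp_rw [tsum_mul_poisson (hL0 s t _)]
    exact lintegral_congr_ae (ae_restrict_of_ae (hLD s t))
  have hmean : ∀ B, MeasurableSet[G ⊥] B → ∀ t,
      ∫⁻ ω in B, (N t ω : ℝ≥0∞) ∂P = ∫⁻ ω in B, D ⊥ t ω ∂P := by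
    intro B hB t
    simpa [hN0] using hfst ⊥ t bot_le B hB
  have hsq : ∀ t, ∫⁻ ω in A, (N t ω : ℝ≥0∞) ^ 2 ∂P =
      ∫⁻ ω in A, (D ⊥ t ω ^ 2 + D ⊥ t ω) ∂P := by
    intro t
    have := (hlaw ⊥ t bot_le).setLIntegral (hG ⊥) (hKm ⊥ t) (hL ⊥ t) hA
      (fun k => (k : ℝ≥0∞) ^ 2)
    simp only [hN0, Nat.sub_zero, tsum_sq_mul_poisson (hL0 ⊥ t _)] at this
    rw [this]
    refine lintegral_congr_ae (ae_restrict_of_ae ?_)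
    filter_upwards [hLD ⊥ t] with ω hω
    rw [hω]
  refine ⟨hmean A hA, fun s t hst => ?_⟩
  have hAm : MeasurableSet A := hG ⊥ A hA
  -- the past value `N s` is uncorrelated, given the past, with the compensated increment
  have hcross : ∫⁻ ω in A, (N s ω : ℝ≥0∞) * ((N t ω - N s ω : ℕ) : ℝ≥0∞) ∂P =
      ∫⁻ ω in A, D ⊥ s ω * D s t ω ∂P := by
    have hφ : Measurable[G s] (A.indicator fun ω => (N s ω : ℝ≥0∞)) :=
      Measurable.indicator (measurable_from_top.comp (hN s)) (hGmono bot_le _ hA)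
    have hψ : Measurable[G ⊥] (A.indicator (D s t)) := Measurable.indicator (hD s t) hA
    have hind : ∀ f g : Ω → ℝ≥0∞,
        ∫⁻ ω, A.indicator f ω * g ω ∂P = ∫⁻ ω in A, f ω * g ω ∂P := fun f g => by
      rw [← lintegral_indicator hAm]
      exact lintegral_congr fun ω => (indicator_mul_left A f g).symm
    have hKE : Measurable fun ω => ((N t ω - N s ω : ℕ) : ℝ≥0∞) :=
      measurable_from_top.comp (hKm s t)
    rw [← hind, lintegral_mul_eq_of_setLIntegral_eq (hG s) hKE.aemeasurable
      (hDm s t).aemeasurable (hfst s t hst) hφ, hind]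
    simp_rw [mul_comm _ (D s t _)]
    rw [← hind, lintegral_mul_eq_of_setLIntegral_eq (hG ⊥) (hNE s).aemeasurable
      (hDm ⊥ s).aemeasurable (fun B hB => hmean B hB s) hψ, hind]
  have hsplit : ∀ ω, (N s ω : ℝ≥0∞) * N t ω =
      (N s ω : ℝ≥0∞) ^ 2 + (N s ω : ℝ≥0∞) * ((N t ω - N s ω : ℕ) : ℝ≥0∞) := by
    intro ω
    have : N t ω = N s ω + (N t ω - N s ω) := by have := hNmono ω hst; simp only at this; omega
    conv_lhs => rw [this]
    push_cast
    ring
  simp_rw [hsplit]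
  rw [lintegral_add_left ((hNE s).pow_const 2), hsq s, hcross,
    ← lintegral_add_left (by fun_prop)]
  refine lintegral_congr fun ω => ?_
  rw [hDadd s t hst ω]
  ring

end CoxMoments

/-! ### Campbell formulas -/

section Campbell

/-- Two finite measures on a product agree if they agree on rectangles whose first side ranges
over a generating π-system. -/
lemma ext_prod_of_generateFrom {J E : Type*} [mJ : MeasurableSpace J] [MeasurableSpace E]
    {μ ν : Measure (J × E)} [IsFiniteMeasure μ] {C : Set (Set J)}
    (hC : mJ = MeasurableSpace.generateFrom C) (hpi : IsPiSystem C) (huniv : univ ∈ C)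
    (h : ∀ s ∈ C, ∀ A, MeasurableSet A → μ (s ×ˢ A) = ν (s ×ˢ A)) : μ = ν := by
  refine Measure.ext_prod fun {s A} hs hA => ?_
  have e : ∀ (ρ : Measure (J × E)) {s : Set J}, MeasurableSet s →
      (ρ.restrict (univ ×ˢ A)).map Prod.fst s = ρ (s ×ˢ A) := by
    intro ρ s hs
    rw [Measure.map_apply measurable_fst hs, Measure.restrict_apply (measurable_fst hs)]
    congr 1
    ext ⟨x, y⟩
    simp
  have hCm : ∀ s ∈ C, MeasurableSet s := fun s hs => by
    rw [hC]; exact MeasurableSpace.measurableSet_generateFrom hs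
  have key : (μ.restrict (univ ×ˢ A)).map Prod.fst = (ν.restrict (univ ×ˢ A)).map Prod.fst := by
    refine ext_of_generate_finite C hC hpi (fun s hs => ?_) ?_
    · rw [e μ (hCm s hs), e ν (hCm s hs), h s hs A hA]
    · rw [e μ .univ, e ν .univ, h _ huniv A hA]
  rw [← e μ hs, ← e ν hs, key]

variable {Ω E : Type*} {mΩ : MeasurableSpace Ω} {mE : MeasurableSpace E} {P : Measure Ω}

/-- Integration against the intensity measure of a countable family of random points `θ k`, the
`k`-th of which is present on the event `D k`. -/
lemma lintegral_sum_map_restrict {X κ : Type*} [MeasurableSpace X] [Countable κ]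
    {D : κ → Set Ω} (hD : ∀ k, MeasurableSet (D k)) {θ : κ → Ω → X} (hθ : ∀ k, Measurable (θ k))
    {g : X → ℝ≥0∞} (hg : Measurable g) :
    ∫⁻ x, g x ∂(Measure.sum fun k => (P.restrict (D k)).map (θ k)) =
      ∫⁻ ω, ∑' k, (D k).indicator (fun ω => g (θ k ω)) ω ∂P := by
  have hm : ∀ k, Measurable ((D k).indicator fun ω => g (θ k ω)) := fun k =>
    (hg.comp (hθ k)).indicator (hD k)
  rw [lintegral_sum_measure, lintegral_tsum fun k => (hm k).aemeasurable]
  refine tsum_congr fun k => ?_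
  rw [lintegral_map hg (hθ k), lintegral_indicator (hD k)]

lemma lintegral_withDensity_prod_map [SFinite P] {J : Type*} [MeasurableSpace J] {ρ : Measure J}
    [SFinite ρ] {π : Ω → E} (hπ : Measurable π) {k g : J × E → ℝ≥0∞} (hk : Measurable k)
    (hg : Measurable g) :
    ∫⁻ x, g x ∂((ρ.prod (P.map π)).withDensity k) =
      ∫⁻ ω, ∫⁻ j, g (j, π ω) * k (j, π ω) ∂ρ ∂P := by
  rw [lintegral_withDensity_eq_lintegral_mul _ hk hg, lintegral_prod_symm' _ (hk.mul hg),
    lintegral_map (hk.mul hg).lintegral_prod_left' hπ]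
  simp only [Pi.mul_apply, mul_comm]

lemma tsum_indicator_lt_natCast (n : Ω → ℕ) (π : Ω → E) (A : Set E) (ω : Ω) :
    ∑' i, {ω | i < n ω}.indicator (fun ω => A.indicator (1 : E → ℝ≥0∞) (π ω)) ω =
      (π ⁻¹' A).indicator (fun ω => (n ω : ℝ≥0∞)) ω := by
  rw [tsum_eq_sum (s := Finset.range (n ω)) (fun i hi => by
    have : ¬ i < n ω := by simpa using hi
    simp [this]), Finset.sum_congr rfl (g := fun _ => A.indicator (1 : E → ℝ≥0∞) (π ω))
      (fun i hi => by simp [Finset.mem_range.1 hi])]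
  by_cases h : π ω ∈ A <;> simp [h]

variable {I : Type*} [LinearOrder I] [OrderTop I] [TopologicalSpace I] [OrderTopology I]
  [SecondCountableTopology I] [MeasurableSpace I] [BorelSpace I]
  {ν : Measure I} {π : Ω → E} {ℓ : I → E → ℝ≥0∞} {N : I → Ω → ℕ} {τ : ℕ → Ω → I}

/-- If the counts `N t` have the mean measure `∫_{(-∞, t]} ℓ dν` on every event depending on `π`,
then so do all sums over the jump times `τ i`. -/
theorem lintegral_tsum_jumps [IsFiniteMeasure P] [SFinite ν] (hπ : Measurable π)
    (hℓ : Measurable (Function.uncurry ℓ)) (hτ : ∀ i, Measurable (τ i))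
    (hN : ∀ t, Measurable (N t)) (hτN : ∀ i t ω, i < N t ω ↔ i < N ⊤ ω ∧ τ i ω ≤ t)
    (h1 : ∀ t A, MeasurableSet A → ∫⁻ ω in π ⁻¹' A, (N t ω : ℝ≥0∞) ∂P =
      ∫⁻ ω in π ⁻¹' A, ∫⁻ s in Iic t, ℓ s (π ω) ∂ν ∂P)
    (hfin : ∫⁻ ω, ∫⁻ s, ℓ s (π ω) ∂ν ∂P ≠ ∞)
    {v : I → E → ℝ≥0∞} (hv : Measurable (Function.uncurry v)) (t : I) :
    ∫⁻ ω, ∑' i, {ω | i < N t ω}.indicator (fun ω => v (τ i ω) (π ω)) ω ∂P =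
      ∫⁻ ω, ∫⁻ s in Iic t, v s (π ω) * ℓ s (π ω) ∂ν ∂P := by
  set D : ℕ → Set Ω := fun i => {ω | i < N ⊤ ω}
  set θ : ℕ → Ω → I × E := fun i ω => (τ i ω, π ω)
  have hD : ∀ i, MeasurableSet (D i) := fun i => measurableSet_lt measurable_const (hN ⊤)
  have hθ : ∀ i, Measurable (θ i) := fun i => (hτ i).prodMk hπ
  -- both sides of the asserted identity, before restricting to `s ≤ t`
  have eL : ∀ {t : I} {v : I → E → ℝ≥0∞}, Measurable (Function.uncurry v) →
      ∫⁻ x, (Iic t ×ˢ univ).indicator (Function.uncurry v) x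
          ∂(Measure.sum fun i => (P.restrict (D i)).map (θ i)) =
        ∫⁻ ω, ∑' i, {ω | i < N t ω}.indicator (fun ω => v (τ i ω) (π ω)) ω ∂P := by
    intro t v hv
    rw [lintegral_sum_map_restrict hD hθ (hv.indicator (measurableSet_Iic.prod .univ))]
    refine lintegral_congr fun ω => tsum_congr fun i => ?_
    by_cases h1 : i < N ⊤ ω <;> by_cases h2 : τ i ω ≤ t <;>
      simp [D, θ, indicator, hτN i t ω, h1, h2]
  have eR : ∀ {t : I} {v : I → E → ℝ≥0∞}, Measurable (Function.uncurry v) →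
      ∫⁻ x, (Iic t ×ˢ univ).indicator (Function.uncurry v) x
          ∂((ν.prod (P.map π)).withDensity (Function.uncurry ℓ)) =
        ∫⁻ ω, ∫⁻ s in Iic t, v s (π ω) * ℓ s (π ω) ∂ν ∂P := by
    intro t v hv
    rw [lintegral_withDensity_prod_map hπ hℓ (hv.indicator (measurableSet_Iic.prod .univ))]
    refine lintegral_congr fun ω => ?_
    rw [← lintegral_indicator measurableSet_Iic]
    refine lintegral_congr fun s => ?_
    by_cases h : s ≤ t <;> simp [indicator, h, Function.uncurry]
  have hrect : ∀ (t : I) (A : Set E), (Iic t ×ˢ A).indicator (1 : I × E → ℝ≥0∞) =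
      (Iic t ×ˢ univ).indicator (Function.uncurry fun _ e => A.indicator 1 e) := by
    intro t A
    ext ⟨s, e⟩
    by_cases h1 : s ≤ t <;> by_cases h2 : e ∈ A <;> simp [indicator, h1, h2]
  have : IsFiniteMeasure ((ν.prod (P.map π)).withDensity (Function.uncurry ℓ)) := by
    refine ⟨lt_top_iff_ne_top.2 ?_⟩
    rw [← lintegral_one, lintegral_withDensity_prod_map hπ hℓ measurable_const]
    simpa [Function.uncurry] using hfin
  -- equality of the two mean measures, tested on the rectangles `Iic t ×ˢ A`
  have hM : (ν.prod (P.map π)).withDensity (Function.uncurry ℓ) =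
      Measure.sum fun i => (P.restrict (D i)).map (θ i) := by
    refine ext_prod_of_generateFrom (C := range Iic)
      ((BorelSpace.measurable_eq).trans (borel_eq_generateFrom_Iic I)) (isPiSystem_Iic)
      ⟨⊤, Iic_top⟩ ?_
    rintro _ ⟨t, rfl⟩ A hA
    have hA' : Measurable (Function.uncurry fun (_ : I) e => A.indicator (1 : E → ℝ≥0∞) e) :=
      (measurable_const.indicator hA).comp measurable_snd
    rw [← lintegral_indicator_one (measurableSet_Iic.prod hA),
      ← lintegral_indicator_one (measurableSet_Iic.prod hA), hrect, eL hA', eR hA']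
    simp_rw [tsum_indicator_lt_natCast]
    rw [lintegral_indicator (hπ hA), h1 t A hA, ← lintegral_indicator (hπ hA)]
    refine lintegral_congr fun ω => ?_
    by_cases h : π ω ∈ A <;> simp [h]
  rw [← eL hv, ← hM, eR hv]

/-- The second-order counterpart of `lintegral_tsum_jumps`: if `N s` and `N t` have the mixed
moments of a Poisson process given `π`, then a sum over the jump times has the second moment of a
Poisson integral. The diagonal of the double sum over jumps produces the term with `v²`. -/
theorem lintegral_tsum_jumps_sq [IsFiniteMeasure P] [SFinite ν] (hπ : Measurable π)
    (hℓ : Measurable (Function.uncurry ℓ)) (hτ : ∀ i, Measurable (τ i))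
    (hN : ∀ t, Measurable (N t)) (hτN : ∀ i t ω, i < N t ω ↔ i < N ⊤ ω ∧ τ i ω ≤ t)
    (h2 : ∀ s t, s ≤ t → ∀ A, MeasurableSet A →
      ∫⁻ ω in π ⁻¹' A, (N s ω : ℝ≥0∞) * N t ω ∂P =
        ∫⁻ ω in π ⁻¹' A, ((∫⁻ r in Iic s, ℓ r (π ω) ∂ν) * (∫⁻ r in Iic t, ℓ r (π ω) ∂ν) +
          ∫⁻ r in Iic s, ℓ r (π ω) ∂ν) ∂P)
    (hfin : ∫⁻ ω, ∫⁻ s, ℓ s (π ω) ∂ν ∂P ≠ ∞)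
    (hfin2 : ∫⁻ ω, (∫⁻ s, ℓ s (π ω) ∂ν) ^ 2 ∂P ≠ ∞)
    {v : I → E → ℝ≥0∞} (hv : Measurable (Function.uncurry v)) (t : I) :
    ∫⁻ ω, (∑' i, {ω | i < N t ω}.indicator (fun ω => v (τ i ω) (π ω)) ω) ^ 2 ∂P =
      ∫⁻ ω, (∫⁻ s in Iic t, v s (π ω) * ℓ s (π ω) ∂ν) ^ 2 ∂P +
        ∫⁻ ω, ∫⁻ s in Iic t, v s (π ω) ^ 2 * ℓ s (π ω) ∂ν ∂P := by
  set D : ℕ × ℕ → Set Ω := fun p => {ω | p.1 < N ⊤ ω} ∩ {ω | p.2 < N ⊤ ω}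
  set θ : ℕ × ℕ → Ω → (I × I) × E := fun p ω => ((τ p.1 ω, τ p.2 ω), π ω)
  set k₂ : (I × I) × E → ℝ≥0∞ := fun x => ℓ x.1.1 x.2 * ℓ x.1.2 x.2
  set diag : I × E → (I × I) × E := fun x => ((x.1, x.1), x.2)
  set M₁ := Measure.sum fun p => (P.restrict (D p)).map (θ p)
  set M₂ := ((ν.prod ν).prod (P.map π)).withDensity k₂
  set M₃ := ((ν.prod (P.map π)).withDensity (Function.uncurry ℓ)).map diag
  have hDi : ∀ i, MeasurableSet {ω | i < N ⊤ ω} := fun i =>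
    measurableSet_lt measurable_const (hN ⊤)
  have hD : ∀ p, MeasurableSet (D p) := fun p => (hDi p.1).inter (hDi p.2)
  have hθ : ∀ p, Measurable (θ p) := fun p => ((hτ p.1).prodMk (hτ p.2)).prodMk hπ
  have hdiag : Measurable diag := by fun_prop
  have hk₂ : Measurable k₂ :=
    (hℓ.comp (by fun_prop : Measurable fun x : (I × I) × E => (x.1.1, x.2))).mul
      (hℓ.comp (by fun_prop : Measurable fun x : (I × I) × E => (x.1.2, x.2)))
  have hℓm : ∀ e, Measurable fun s => ℓ s e := fun e => hℓ.comp measurable_prodMk_right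
  -- the test functions: products `1_{r ≤ s} v₁ r e * 1_{r' ≤ t} v₂ r' e`
  set φ : I → I → (I → E → ℝ≥0∞) → (I → E → ℝ≥0∞) → (I × I) × E → ℝ≥0∞ := fun s t v₁ v₂ x =>
    (Iic s).indicator (fun r => v₁ r x.2) x.1.1 * (Iic t).indicator (fun r => v₂ r x.2) x.1.2
  have hφ : ∀ s t {v₁ v₂ : I → E → ℝ≥0∞}, Measurable (Function.uncurry v₁) →
      Measurable (Function.uncurry v₂) → Measurable (φ s t v₁ v₂) := by
    intro s t v₁ v₂ h₁ h₂
    have e : ∀ (s : I) {v : I → E → ℝ≥0∞}, Measurable (Function.uncurry v) →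
        Measurable fun x : I × E => (Iic s).indicator (fun r => v r x.2) x.1 := fun s v hv =>
      hv.indicator (measurable_fst measurableSet_Iic)
    exact ((e s h₁).comp (by fun_prop : Measurable fun x : (I × I) × E => (x.1.1, x.2))).mul
      ((e t h₂).comp (by fun_prop : Measurable fun x : (I × I) × E => (x.1.2, x.2)))
  have e₁ : ∀ s t {v₁ v₂ : I → E → ℝ≥0∞}, Measurable (Function.uncurry v₁) →
      Measurable (Function.uncurry v₂) → ∫⁻ x, φ s t v₁ v₂ x ∂M₁ =
        ∫⁻ ω, (∑' i, {ω | i < N s ω}.indicator (fun ω => v₁ (τ i ω) (π ω)) ω) *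
          (∑' i, {ω | i < N t ω}.indicator (fun ω => v₂ (τ i ω) (π ω)) ω) ∂P := by
    intro s t v₁ v₂ h₁ h₂
    rw [lintegral_sum_map_restrict hD hθ (hφ s t h₁ h₂)]
    refine lintegral_congr fun ω => ?_
    rw [ENNReal.tsum_prod', ← ENNReal.tsum_mul_right]
    refine tsum_congr fun i => ?_
    rw [← ENNReal.tsum_mul_left]
    refine tsum_congr fun j => ?_
    by_cases a1 : i < N ⊤ ω <;> by_cases a2 : τ i ω ≤ s <;> by_cases a3 : j < N ⊤ ω <;>
      by_cases a4 : τ j ω ≤ t <;>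
      simp [D, θ, φ, indicator, hτN i s ω, hτN j t ω, a1, a2, a3, a4]
  have e₂ : ∀ s t {v₁ v₂ : I → E → ℝ≥0∞}, Measurable (Function.uncurry v₁) →
      Measurable (Function.uncurry v₂) → ∫⁻ x, φ s t v₁ v₂ x ∂M₂ =
        ∫⁻ ω, (∫⁻ r in Iic s, v₁ r (π ω) * ℓ r (π ω) ∂ν) *
          (∫⁻ r in Iic t, v₂ r (π ω) * ℓ r (π ω) ∂ν) ∂P := by
    intro s t v₁ v₂ h₁ h₂
    rw [lintegral_withDensity_prod_map hπ hk₂ (hφ s t h₁ h₂)]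
    refine lintegral_congr fun ω => ?_
    have hm : ∀ (s : I) {v : I → E → ℝ≥0∞}, Measurable (Function.uncurry v) →
        Measurable ((Iic s).indicator fun r => v r (π ω) * ℓ r (π ω)) := fun s v hv =>
      ((hv.comp measurable_prodMk_right).mul (hℓm _)).indicator measurableSet_Iic
    rw [← lintegral_indicator measurableSet_Iic, ← lintegral_indicator measurableSet_Iic,
      ← lintegral_prod_mul (hm s h₁).aemeasurable (hm t h₂).aemeasurable]
    refine lintegral_congr fun x => ?_
    by_cases a1 : x.1 ≤ s <;> by_cases a2 : x.2 ≤ t <;> simp [φ, k₂, indicator, a1, a2]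
    ring
  have e₃ : ∀ s t {v₁ v₂ : I → E → ℝ≥0∞}, Measurable (Function.uncurry v₁) →
      Measurable (Function.uncurry v₂) → ∫⁻ x, φ s t v₁ v₂ x ∂M₃ =
        ∫⁻ ω, ∫⁻ r in Iic (min s t), v₁ r (π ω) * v₂ r (π ω) * ℓ r (π ω) ∂ν ∂P := by
    intro s t v₁ v₂ h₁ h₂
    rw [lintegral_map (hφ s t h₁ h₂) hdiag,
      lintegral_withDensity_prod_map hπ hℓ (g := fun x => φ s t v₁ v₂ (diag x))
        ((hφ s t h₁ h₂).comp hdiag)]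
    refine lintegral_congr fun ω => ?_
    rw [← lintegral_indicator measurableSet_Iic]
    refine lintegral_congr fun r => ?_
    by_cases a1 : r ≤ s <;> by_cases a2 : r ≤ t <;>
      simp [φ, diag, indicator, a1, a2, Function.uncurry]
  have : IsFiniteMeasure (M₂ + M₃) := by
    have hone : Measurable (Function.uncurry fun (_ : I) (_ : E) => (1 : ℝ≥0∞)) :=
      measurable_const
    refine ⟨lt_top_iff_ne_top.2 ?_⟩
    rw [← lintegral_one, lintegral_congr (g := φ ⊤ ⊤ (fun _ _ => 1) (fun _ _ => 1))
      (fun x => by simp [φ]), lintegral_add_measure, e₂ ⊤ ⊤ hone hone, e₃ ⊤ ⊤ hone hone]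
    simpa [← pow_two] using ⟨hfin2, hfin⟩
  -- `M₁` is the mean measure of pairs of jumps; `M₃` is carried by the diagonal
  have hM : M₂ + M₃ = M₁ := by
    refine ext_prod_of_generateFrom (C := image2 (· ×ˢ ·) (range Iic) (range Iic)) ?_
      (isPiSystem_Iic.prod isPiSystem_Iic) ⟨_, ⟨⊤, rfl⟩, _, ⟨⊤, rfl⟩, by simp⟩ ?_
    · have hI : MeasurableSpace.generateFrom (range (Iic : I → Set I)) = ‹MeasurableSpace I› :=
        ((BorelSpace.measurable_eq).trans (borel_eq_generateFrom_Iic I)).symm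
      have hsp : IsCountablySpanning (range (Iic : I → Set I)) :=
        ⟨fun _ => Iic ⊤, fun _ => ⟨⊤, rfl⟩, by simp [iUnion_const]⟩
      exact (generateFrom_eq_prod hI hI hsp hsp).symm
    have hcase : ∀ (s t : I) (A : Set E), MeasurableSet A →
        (M₂ + M₃) ((Iic s ×ˢ Iic t) ×ˢ A) = M₁ ((Iic s ×ˢ Iic t) ×ˢ A) := by
      intro s t A hA
      have hA' : Measurable (Function.uncurry fun (_ : I) e => A.indicator (1 : E → ℝ≥0∞) e) :=
        (measurable_const.indicator hA).comp measurable_snd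
      have hind : ((Iic s ×ˢ Iic t) ×ˢ A).indicator 1 =
          φ s t (fun _ e => A.indicator 1 e) (fun _ e => A.indicator 1 e) := by
        ext ⟨⟨r, r'⟩, e⟩
        by_cases a1 : r ≤ s <;> by_cases a2 : r' ≤ t <;> by_cases a3 : e ∈ A <;>
          simp [φ, indicator, a1, a2, a3]
      have hR : MeasurableSet ((Iic s ×ˢ Iic t) ×ˢ A) :=
        (measurableSet_Iic.prod measurableSet_Iic).prod hA
      rw [← lintegral_indicator_one hR, ← lintegral_indicator_one hR, hind,
        lintegral_add_measure, e₁ s t hA' hA', e₂ s t hA' hA', e₃ s t hA' hA']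
      simp_rw [tsum_indicator_lt_natCast]
      have hLm : ∀ s, Measurable fun ω => ∫⁻ r in Iic s, ℓ r (π ω) ∂ν := fun s =>
        (Measurable.lintegral_prod_left' (f := Function.uncurry ℓ) hℓ).comp hπ
      have hprod : ∀ a b : Ω → ℝ≥0∞, (fun ω => (π ⁻¹' A).indicator a ω *
          (π ⁻¹' A).indicator b ω) = (π ⁻¹' A).indicator fun ω => a ω * b ω := fun a b => by
        ext ω
        by_cases h : π ω ∈ A <;> simp [h]
      have hL₁ : ∀ s ω, ∫⁻ r in Iic s, A.indicator 1 (π ω) * ℓ r (π ω) ∂ν =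
          (π ⁻¹' A).indicator (fun ω => ∫⁻ r in Iic s, ℓ r (π ω) ∂ν) ω := fun s ω => by
        by_cases h : π ω ∈ A <;> simp [h]
      have hL₂ : ∀ s ω, ∫⁻ r in Iic s, A.indicator 1 (π ω) * A.indicator 1 (π ω) *
          ℓ r (π ω) ∂ν = (π ⁻¹' A).indicator (fun ω => ∫⁻ r in Iic s, ℓ r (π ω) ∂ν) ω :=
        fun s ω => by by_cases h : π ω ∈ A <;> simp [h]
      simp_rw [hL₁, hL₂, hprod]
      rw [lintegral_indicator (hπ hA), lintegral_indicator (hπ hA), lintegral_indicator (hπ hA),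
        ← lintegral_add_right _ (hLm _)]
      rcases le_total s t with hst | hts
      · rw [h2 s t hst A hA, min_eq_left hst]
      · simp_rw [mul_comm (N s _ : ℝ≥0∞), h2 t s hts A hA, min_eq_right hts, mul_comm]
    rintro _ ⟨_, ⟨s, rfl⟩, _, ⟨t, rfl⟩, rfl⟩ A hA
    exact hcase s t A hA
  have := e₁ t t hv hv
  rw [← hM, lintegral_add_measure, e₂ t t hv hv, e₃ t t hv hv, min_self] at this
  simp_rw [pow_two]
  exact this.symm

end Campbell

/-! ### Random sums with independent marks -/

section CompoundSum

variable {Ω : Type*} {m mΩ : MeasurableSpace Ω} {P : Measure Ω} {a z : ℕ → Ω → ℝ≥0∞}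
  {c₁ c₂ : ℝ≥0∞}

lemma lintegral_tsum_mul_of_indep (hm : m ≤ mΩ) (ha : ∀ i, Measurable[m] (a i))
    (hz : ∀ i, Measurable (z i))
    (hind : Indep (⨆ i, MeasurableSpace.comap (z i) inferInstance) m P)
    (h1 : ∀ i, ∫⁻ ω, z i ω ∂P = c₁) :
    ∫⁻ ω, ∑' i, a i ω * z i ω ∂P = c₁ * ∫⁻ ω, ∑' i, a i ω ∂P := by
  have ham : ∀ i, Measurable (a i) := fun i => (ha i).mono hm le_rfl
  rw [lintegral_tsum fun i => ((ham i).fun_mul (hz i)).aemeasurable,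
    lintegral_tsum fun i => (ham i).aemeasurable, ← ENNReal.tsum_mul_left]
  refine tsum_congr fun i => ?_
  rw [lintegral_mul_eq_lintegral_mul_lintegral_of_independent_measurableSpace hm
    (iSup_le fun i => (hz i).comap_le) hind.symm (ha i)
    (measurable_iff_comap_le.2
      (le_iSup (fun i => MeasurableSpace.comap (z i) inferInstance) i)), h1, mul_comm]

/-- The second moment of a sum `∑ aᵢ zᵢ` whose i.i.d. marks `zᵢ` have moments `c₁`, `c₂` and are
independent of the weights `aᵢ`. The term with `c₁²` on the left avoids a subtraction in
`[0, ∞]`. -/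
lemma lintegral_tsum_mul_sq_of_indep (hm : m ≤ mΩ) (ha : ∀ i, Measurable[m] (a i))
    (hz : ∀ i, Measurable (z i))
    (hind : Indep (⨆ i, MeasurableSpace.comap (z i) inferInstance) m P)
    (hiind : Pairwise fun i j => IndepFun (z i) (z j) P)
    (h1 : ∀ i, ∫⁻ ω, z i ω ∂P = c₁) (h2 : ∀ i, ∫⁻ ω, z i ω ^ 2 ∂P = c₂) :
    ∫⁻ ω, (∑' i, a i ω * z i ω) ^ 2 ∂P + c₁ ^ 2 * ∫⁻ ω, ∑' i, a i ω ^ 2 ∂P =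
      c₂ * ∫⁻ ω, ∑' i, a i ω ^ 2 ∂P + c₁ ^ 2 * ∫⁻ ω, (∑' i, a i ω) ^ 2 ∂P := by
  have ham : ∀ i, Measurable (a i) := fun i => (ha i).mono hm le_rfl
  have hsq : ∀ x : ℕ → ℝ≥0∞, (∑' i, x i) ^ 2 = ∑' i, ∑' j, x i * x j := fun x => by
    simp_rw [pow_two, ENNReal.tsum_mul_left, ENNReal.tsum_mul_right]
  have hsqint : ∀ {x : ℕ → Ω → ℝ≥0∞}, (∀ i, Measurable (x i)) →
      ∫⁻ ω, (∑' i, x i ω) ^ 2 ∂P = ∑' i, ∑' j, ∫⁻ ω, x i ω * x j ω ∂P := fun {x} hx => by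
    simp_rw [hsq]
    rw [lintegral_tsum fun i => (Measurable.tsum fun j =>
      (hx i).fun_mul (hx j)).aemeasurable]
    refine tsum_congr fun i => ?_
    rw [lintegral_tsum fun j => ((hx i).fun_mul (hx j)).aemeasurable]
  have hzz : ∀ i j, ∫⁻ ω, z i ω * z j ω ∂P = if j = i then c₂ else c₁ ^ 2 := by
    intro i j
    split_ifs with hij
    · subst hij
      simp_rw [← pow_two, h2]
    · have := lintegral_mul_eq_lintegral_mul_lintegral_of_indepFun (hz i) (hz j)
        (hiind (Ne.symm hij))
      simp only [Pi.mul_apply] at this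
      rw [this, h1, h1, pow_two]
  have hterm : ∀ i j, ∫⁻ ω, (a i ω * z i ω) * (a j ω * z j ω) ∂P =
      (∫⁻ ω, a i ω * a j ω ∂P) * if j = i then c₂ else c₁ ^ 2 := by
    intro i j
    have hzm : ∀ i, Measurable[⨆ i, MeasurableSpace.comap (z i) inferInstance] (z i) := fun i =>
      measurable_iff_comap_le.2 (le_iSup (fun i => MeasurableSpace.comap (z i) inferInstance) i)
    rw [← hzz, ← lintegral_mul_eq_lintegral_mul_lintegral_of_independent_measurableSpace hm
      (iSup_le fun i => (hz i).comap_le) hind.symm (Measurable.fun_mul (ha i) (ha j))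
      (Measurable.fun_mul (hzm i) (hzm j))]
    exact lintegral_congr fun ω => by ring
  -- both sides are double sums over `i, j`; for each `i` the terms with `j = i` are split off
  rw [hsqint fun i => (ham i).fun_mul (hz i), hsqint ham,
    lintegral_tsum fun i => ((ham i).pow_const 2).aemeasurable, ← ENNReal.tsum_mul_left,
    ← ENNReal.tsum_mul_left, ← ENNReal.tsum_mul_left, ← ENNReal.tsum_add, ← ENNReal.tsum_add]
  refine tsum_congr fun i => ?_
  simp_rw [hterm]
  have hd : ∀ d : ℕ → ℝ≥0∞, ∑' j, d j = d i + ∑' j, if j = i then 0 else d j := fun d =>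
    by convert ENNReal.tsum_eq_add_tsum_ite i
  rw [hd, hd (fun j => ∫⁻ ω, a i ω * a j ω ∂P)]
  have hoff : (∑' j, if j = i then 0 else
      (∫⁻ ω, a i ω * a j ω ∂P) * if j = i then c₂ else c₁ ^ 2) =
        c₁ ^ 2 * ∑' j, if j = i then 0 else ∫⁻ ω, a i ω * a j ω ∂P := by
    rw [← ENNReal.tsum_mul_left]
    refine tsum_congr fun j => ?_
    split_ifs <;> simp [mul_comm]
  rw [hoff]
  simp only [if_true, ← pow_two]
  ring

end CompoundSum

/-! ### Jump times and Stieltjes integrals -/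

section Jumps

variable {I : Type*} [CompleteLinearOrder I]

/-- The time of the jump of the counting path `n` from at most `i` to above `i` (and `⊤` if there
is none). -/
def jumpTime (n : I → ℕ) (i : ℕ) : I := sInf {t | i < n t}

lemma lt_iff_jumpTime_le [TopologicalSpace I] [OrderTopology I] {n : I → ℕ} (hn : Monotone n)
    (hc : ∀ t, ContinuousWithinAt n (Ici t) t) (i : ℕ) (t : I) :
    i < n t ↔ i < n ⊤ ∧ jumpTime n i ≤ t := by
  refine ⟨fun h => ⟨h.trans_le (hn le_top), sInf_le h⟩, fun ⟨h, hle⟩ => ?_⟩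
  -- the infimum is attained, by right-continuity
  suffices hmem : i < n (jumpTime n i) from hmem.trans_le (hn hle)
  have hcl : jumpTime n i ∈ closure {t | i < n t} := sInf_mem_closure ⟨⊤, h⟩
  have hnb : ∃ᶠ s in 𝓝[Ici (jumpTime n i)] (jumpTime n i), i < n s := by
    rw [frequently_nhdsWithin_iff]
    exact (mem_closure_iff_frequently.1 hcl).mono fun s hs => ⟨hs, sInf_le hs⟩
  have hev : ∀ᶠ s in 𝓝[Ici (jumpTime n i)] (jumpTime n i), n s = n (jumpTime n i) :=
    (hc (jumpTime n i)).eventually_mem ((isOpen_discrete {n (jumpTime n i)}).mem_nhds rfl)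
  obtain ⟨s, hs, hs'⟩ := (hnb.and_eventually hev).exists
  exact hs' ▸ hs

lemma measurable_jumpTime [TopologicalSpace I] [OrderTopology I] [SecondCountableTopology I]
    [MeasurableSpace I] [BorelSpace I] {Ω : Type*} {mΩ : MeasurableSpace Ω} {N : I → Ω → ℕ}
    (hN : ∀ t, Measurable (N t)) (hmono : ∀ ω, Monotone fun t => N t ω)
    (hc : ∀ ω t, ContinuousWithinAt (fun r => N r ω) (Ici t) t) (i : ℕ) :
    Measurable fun ω => jumpTime (fun t => N t ω) i := by
  refine measurable_of_Iic fun t => ?_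
  -- the second set accounts for the value `⊤` of the infimum of the empty set
  have : (fun ω => jumpTime (fun t => N t ω) i) ⁻¹' Iic t =
      {ω | i < N t ω} ∪ ({ω | N ⊤ ω ≤ i} ∩ {_ω | (⊤ : I) ≤ t}) := by
    ext ω
    have h := lt_iff_jumpTime_le (hmono ω) (hc ω) i t
    simp only [mem_preimage, mem_Iic, mem_union, mem_inter_iff, mem_ofPred_eq]
    by_cases hi : i < N ⊤ ω
    · simp [h, hi]
    · have hempty : {s | i < N s ω} = ∅ := by
        ext s
        have := hmono ω (le_top : s ≤ ⊤)
        simp only at this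
        simp only [mem_ofPred_eq, mem_empty_iff_false, iff_false]
        omega
      have hj : jumpTime (fun t => N t ω) i = ⊤ := by
        simp only [jumpTime, hempty, sInf_empty]
      have hnot : ¬ i < N t ω := fun hlt => hi (h.1 hlt).1
      simp [hj, not_lt.1 hi, hnot]
  rw [this]
  exact (measurableSet_lt measurable_const (hN t)).union
    ((measurableSet_le (hN ⊤) measurable_const).inter (MeasurableSet.const _))

end Jumps

section PathIntegral

variable {T : ℝ} [Fact (0 ≤ T)]

/-- The Stieltjes measure of a path `t ↦ ∑_{i < n t} ζᵢ` has an atom of mass `ζᵢ` at the time of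
the `i`-th jump. -/
lemma stieltjesMeasure_sum_range {n : Icc (0 : ℝ) T → ℕ} (hn : Monotone n)
    (hc : ∀ t, ContinuousWithinAt n (Ici t) t) (hn0 : n ⊥ = 0) {ζ : ℕ → ℝ} (hζ : ∀ i, 0 ≤ ζ i) :
    stieltjesMeasure (fun t => ∑ i ∈ Finset.range (n t), ζ i) =
      ∑ i ∈ Finset.range (n ⊤), ENNReal.ofReal (ζ i) • Measure.dirac (jumpTime n i) := by
  set f : Icc (0 : ℝ) T → ℝ := fun t => ∑ i ∈ Finset.range (n t), ζ i
  have hmono : Monotone f := fun s t hst =>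
    Finset.sum_le_sum_of_subset_of_nonneg (Finset.range_mono (hn hst)) fun i _ _ => hζ i
  have hcont : ∀ x, ContinuousWithinAt f (Ici x) x := fun x =>
    (continuous_of_discreteTopology (f := fun k : ℕ =>
      ∑ i ∈ Finset.range k, ζ i)).continuousAt.comp_continuousWithinAt (hc x)
  have hf0 : Tendsto f atBot (𝓝 0) := by
    rw [atBot_eq_pure_of_isBot isBot_bot]
    have : f ⊥ = 0 := by simp [f, hn0]
    simpa [this] using tendsto_pure_nhds f ⊥
  have hfin : IsFiniteMeasure (∑ i ∈ Finset.range (n ⊤),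
      ENNReal.ofReal (ζ i) • Measure.dirac (jumpTime n i)) := by
    refine ⟨?_⟩
    simp [Measure.finsetSum_apply]
  rw [stieltjesMeasure, dif_pos ⟨hmono, hcont⟩]
  refine (Measure.ext_of_Iic _ _ fun t => ?_).symm
  rw [StieltjesFunction.measure_Iic _ hf0, sub_zero]
  change _ = ENNReal.ofReal (∑ i ∈ Finset.range (n t), ζ i)
  rw [ENNReal.ofReal_sum_of_nonneg fun i _ => hζ i]
  simp only [Measure.finsetSum_apply, Measure.smul_apply, smul_eq_mul]
  have hsub : Finset.range (n t) ⊆ Finset.range (n ⊤) := Finset.range_mono (hn le_top)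
  rw [← Finset.sum_subset hsub]
  · refine Finset.sum_congr rfl fun i hi => ?_
    have := (lt_iff_jumpTime_le hn hc i t).1 (Finset.mem_range.1 hi)
    rw [Measure.dirac_apply' _ measurableSet_Iic, indicator_of_mem (mem_Iic.2 this.2),
      Pi.one_apply, mul_one]
  · intro i hi hit
    have : jumpTime n i ∉ Iic t := fun hle =>
      hit (Finset.mem_range.2 ((lt_iff_jumpTime_le hn hc i t).2 ⟨Finset.mem_range.1 hi, hle⟩))
    rw [Measure.dirac_apply' _ measurableSet_Iic, indicator_of_notMem this, mul_zero]

lemma setIntegral_stieltjesMeasure_sum_range {n : Icc (0 : ℝ) T → ℕ} (hn : Monotone n)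
    (hc : ∀ t, ContinuousWithinAt n (Ici t) t) (hn0 : n ⊥ = 0) {ζ : ℕ → ℝ} (hζ : ∀ i, 0 ≤ ζ i)
    (u : Icc (0 : ℝ) T → ℝ) (t : Icc (0 : ℝ) T) :
    ∫ s in Iic t, u s ∂(stieltjesMeasure fun t => ∑ i ∈ Finset.range (n t), ζ i) =
      ∑ i ∈ Finset.range (n t), u (jumpTime n i) * ζ i := by
  rw [stieltjesMeasure_sum_range hn hc hn0 hζ, ← integral_indicator measurableSet_Iic,
    integral_finsetSum_measure fun i _ =>
      (integrable_dirac (by simp)).smul_measure ENNReal.ofReal_ne_top]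
  simp only [integral_smul_measure, integral_dirac, ENNReal.toReal_ofReal (hζ _), smul_eq_mul]
  have hsub : Finset.range (n t) ⊆ Finset.range (n ⊤) := Finset.range_mono (hn le_top)
  rw [← Finset.sum_subset hsub]
  · refine Finset.sum_congr rfl fun i hi => ?_
    have := (lt_iff_jumpTime_le hn hc i t).1 (Finset.mem_range.1 hi)
    rw [indicator_of_mem (mem_Iic.2 this.2), mul_comm]
  · intro i hi hit
    have : jumpTime n i ∉ Iic t := fun hle =>
      hit (Finset.mem_range.2 ((lt_iff_jumpTime_le hn hc i t).2 ⟨Finset.mem_range.1 hi, hle⟩))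
    rw [indicator_of_notMem this, mul_zero]

end PathIntegral

/-! ### Moments of a compound Cox sum -/

section CompoundCox

lemma setLIntegral_Iic_eq_Ioc_bot {I : Type*} [LinearOrder I] [OrderBot I] [MeasurableSpace I]
    {ν : Measure I} [NullSingletonClass ν] (f : I → ℝ≥0∞) (t : I) :
    ∫⁻ s in Iic t, f s ∂ν = ∫⁻ s in Ioc ⊥ t, f s ∂ν := by
  rw [← Icc_bot]
  exact (setLIntegral_congr Ioc_ae_eq_Icc).symm

lemma measurable_setLIntegral_left {I Ω : Type*} [MeasurableSpace I] {m : MeasurableSpace Ω}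
    {ν : Measure I} [SFinite ν] {ℓ : I → Ω → ℝ≥0∞} (hℓ : Measurable (Function.uncurry ℓ))
    (A : Set I) : Measurable fun ω => ∫⁻ s in A, ℓ s ω ∂ν :=
  Measurable.lintegral_prod_left' (f := Function.uncurry ℓ) hℓ

variable {I Ω : Type*} [CompleteLinearOrder I] [TopologicalSpace I] [OrderTopology I]
  [SecondCountableTopology I] [MeasurableSpace I] [BorelSpace I] {ν : Measure I} [SFinite ν]
  [NullSingletonClass ν]
  {m m' mΩ : MeasurableSpace Ω} {P : Measure Ω} [IsProbabilityMeasure P]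

/-- First and second moments, in `[0, ∞]`, of `∑_{i < N t} v (τ i) zᵢ`, where `τ i` are the jump
times of a Cox process `N` whose intensity `ℓ` and weight `v` are `m`-measurable, and the i.i.d.
marks `zᵢ` are independent of `m'`, which carries both `m` and `N`. -/
theorem lintegral_compoundCox {G : I → MeasurableSpace Ω} (hG : ∀ s, G s ≤ mΩ)
    (hGmono : Monotone G) (hmG : m ≤ G ⊥) (hm' : m' ≤ mΩ) (hmm' : m ≤ m') {N : I → Ω → ℕ}
    (hN : ∀ s, Measurable[G s] (N s)) (hN' : ∀ s, Measurable[m'] (N s))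
    (hN0 : ∀ ω, N ⊥ ω = 0) (hNmono : ∀ ω, Monotone fun t => N t ω)
    (hNc : ∀ ω t, ContinuousWithinAt (fun r => N r ω) (Ici t) t)
    {ℓ v : I → Ω → ℝ≥0∞} (hℓ : Measurable[Prod.instMeasurableSpace (m₂ := m)] (Function.uncurry ℓ))
    (hv : Measurable[Prod.instMeasurableSpace (m₂ := m)] (Function.uncurry v))
    (hfin : ∫⁻ ω, ∫⁻ s, ℓ s ω ∂ν ∂P ≠ ∞) (hfin2 : ∫⁻ ω, (∫⁻ s, ℓ s ω ∂ν) ^ 2 ∂P ≠ ∞)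
    (hlaw : ∀ s t, s ≤ t → HasConditionalPoissonLaw P (G s) (fun ω => N t ω - N s ω)
      fun ω => (∫⁻ r in Ioc s t, ℓ r ω ∂ν).toReal)
    {z : ℕ → Ω → ℝ≥0∞} (hz : ∀ i, Measurable (z i))
    (hind : Indep (⨆ i, MeasurableSpace.comap (z i) inferInstance) m' P)
    (hiind : Pairwise fun i j => IndepFun (z i) (z j) P)
    {c₁ c₂ : ℝ≥0∞} (h1 : ∀ i, ∫⁻ ω, z i ω ∂P = c₁) (h2 : ∀ i, ∫⁻ ω, z i ω ^ 2 ∂P = c₂)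
    (t : I) :
    let a : ℕ → Ω → ℝ≥0∞ := fun i =>
      {ω | i < N t ω}.indicator fun ω => v (jumpTime (fun t => N t ω) i) ω
    (∀ i, Measurable (a i)) ∧
    ∫⁻ ω, ∑' i, a i ω * z i ω ∂P = c₁ * ∫⁻ ω, ∫⁻ s in Iic t, v s ω * ℓ s ω ∂ν ∂P ∧
    ∫⁻ ω, (∑' i, a i ω * z i ω) ^ 2 ∂P + c₁ ^ 2 * ∫⁻ ω, ∫⁻ s in Iic t, v s ω ^ 2 * ℓ s ω ∂ν ∂P =
      c₂ * ∫⁻ ω, ∫⁻ s in Iic t, v s ω ^ 2 * ℓ s ω ∂ν ∂P +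
        c₁ ^ 2 * (∫⁻ ω, (∫⁻ s in Iic t, v s ω * ℓ s ω ∂ν) ^ 2 ∂P +
          ∫⁻ ω, ∫⁻ s in Iic t, v s ω ^ 2 * ℓ s ω ∂ν ∂P) := by
  intro a
  have hm : m ≤ mΩ := hmG.trans (hG ⊥)
  set τ : ℕ → Ω → I := fun i ω => jumpTime (fun t => N t ω) i
  have hNm : ∀ t, Measurable (N t) := fun t => (hN' t).mono hm' le_rfl
  have hτ : ∀ i, Measurable (τ i) := measurable_jumpTime hNm hNmono hNc
  have hτ' : ∀ i, Measurable[m'] (τ i) := fun i =>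
    measurable_jumpTime (mΩ := m') hN' hNmono hNc i
  have hτN : ∀ i t ω, i < N t ω ↔ i < N ⊤ ω ∧ τ i ω ≤ t := fun i t ω =>
    lt_iff_jumpTime_le (hNmono ω) (hNc ω) i t
  have ha : ∀ i, Measurable[m'] (a i) := by
    intro i
    refine Measurable.indicator ?_ (hN' t measurableSet_Ioi)
    have hid : Measurable[m', m] (id : Ω → Ω) := measurable_id.mono le_rfl hmm'
    exact hv.comp ((hτ' i).prodMk hid)
  have hDm : ∀ s t, Measurable[m] fun ω => ∫⁻ r in Ioc s t, ℓ r ω ∂ν := fun s t =>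
    measurable_setLIntegral_left hℓ _
  have hDfin : ∀ s t, ∀ᵐ ω ∂P, ∫⁻ r in Ioc s t, ℓ r ω ∂ν ≠ ∞ := by
    intro s t
    have hLm : Measurable[m] fun ω => ∫⁻ r, ℓ r ω ∂ν := by
      simpa using measurable_setLIntegral_left hℓ univ
    filter_upwards [ae_lt_top (hLm.mono hm le_rfl) hfin] with ω hω
    exact ((setLIntegral_le_lintegral _ _).trans_lt hω).ne
  have hmom : ∀ A, MeasurableSet[m] A → _ := fun A hA =>
    setLIntegral_natCast_of_hasConditionalPoissonLaw (P := P) hG hGmono hN hN0 hNmono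
      (L := fun s t ω => (∫⁻ r in Ioc s t, ℓ r ω ∂ν).toReal)
      (D := fun s t ω => ∫⁻ r in Ioc s t, ℓ r ω ∂ν) (fun _ _ _ => ENNReal.toReal_nonneg)
      (fun s t => by
        filter_upwards [hDfin s t] with ω hω
        exact ENNReal.ofReal_toReal hω)
      (fun s t => ((hDm s t).mono hm le_rfl).ennreal_toReal.aemeasurable)
      (fun s t => (hDm s t).mono hmG le_rfl)
      (fun s t hst ω => by
        rw [← Ioc_union_Ioc_eq_Ioc (bot_le (a := s)) hst,
          lintegral_union measurableSet_Ioc (Ioc_disjoint_Ioc_of_le le_rfl)])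
      hlaw (hmG A hA)
  -- the Campbell formulas are applied with the identity map onto `Ω` with the σ-algebra `m`
  have hid : Measurable[mΩ, m] (id : Ω → Ω) := measurable_id.mono le_rfl hm
  have hm1 : ∀ t A, MeasurableSet[m] A → ∫⁻ ω in id ⁻¹' A, (N t ω : ℝ≥0∞) ∂P =
      ∫⁻ ω in id ⁻¹' A, ∫⁻ s in Iic t, ℓ s (id ω) ∂ν ∂P := fun t A hA => by
    simp_rw [setLIntegral_Iic_eq_Ioc_bot]
    exact (hmom A hA).1 t
  have hm2 : ∀ s t, s ≤ t → ∀ A, MeasurableSet[m] A →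
      ∫⁻ ω in id ⁻¹' A, (N s ω : ℝ≥0∞) * N t ω ∂P =
        ∫⁻ ω in id ⁻¹' A, ((∫⁻ r in Iic s, ℓ r (id ω) ∂ν) * (∫⁻ r in Iic t, ℓ r (id ω) ∂ν) +
          ∫⁻ r in Iic s, ℓ r (id ω) ∂ν) ∂P := fun s t hst A hA => by
    simp_rw [setLIntegral_Iic_eq_Ioc_bot]
    exact (hmom A hA).2 s t hst
  have hC1 : ∀ {w : I → Ω → ℝ≥0∞},
      Measurable[Prod.instMeasurableSpace (m₂ := m)] (Function.uncurry w) →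
      ∫⁻ ω, ∑' i, {ω | i < N t ω}.indicator (fun ω => w (τ i ω) ω) ω ∂P =
        ∫⁻ ω, ∫⁻ s in Iic t, w s ω * ℓ s ω ∂ν ∂P := fun hw =>
    lintegral_tsum_jumps (mE := m) (π := id) hid hℓ hτ hNm hτN hm1 hfin hw t
  have hC2 : ∫⁻ ω, (∑' i, a i ω) ^ 2 ∂P =
      ∫⁻ ω, (∫⁻ s in Iic t, v s ω * ℓ s ω ∂ν) ^ 2 ∂P +
        ∫⁻ ω, ∫⁻ s in Iic t, v s ω ^ 2 * ℓ s ω ∂ν ∂P :=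
    lintegral_tsum_jumps_sq (mE := m) (π := id) hid hℓ hτ hNm hτN hm2 hfin hfin2 hv t
  have hsq : ∫⁻ ω, ∑' i, a i ω ^ 2 ∂P = ∫⁻ ω, ∫⁻ s in Iic t, v s ω ^ 2 * ℓ s ω ∂ν ∂P := by
    rw [← hC1 (w := fun s ω => v s ω ^ 2) (Measurable.pow_const hv 2)]
    refine lintegral_congr fun ω => tsum_congr fun i => ?_
    by_cases h : i < N t ω <;> simp [a, τ, indicator, h]
  refine ⟨fun i => (ha i).mono hm' le_rfl, ?_, ?_⟩
  · rw [lintegral_tsum_mul_of_indep hm' ha hz hind h1, ← hC1 hv]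
  · rw [← hsq, lintegral_tsum_mul_sq_of_indep hm' ha hz hind hiind h1 h2, hC2, hsq]

end CompoundCox

/-! ### Passage to real-valued random variables -/

section RealValued

variable {Ω : Type*} {mΩ : MeasurableSpace Ω} {P : Measure Ω}

lemma integral_eq_of_ofReal_ae_eq {X : Ω → ℝ} {U : Ω → ℝ≥0∞} (hX : 0 ≤ᵐ[P] X)
    (hU : AEMeasurable U P) (hXU : ∀ᵐ ω ∂P, ENNReal.ofReal (X ω) = U ω)
    (hfin : ∫⁻ ω, U ω ∂P ≠ ∞) :
    Integrable X P ∧ ∫ ω, X ω ∂P = (∫⁻ ω, U ω ∂P).toReal := by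
  have hXm : AEStronglyMeasurable X P := by
    refine (hU.ennreal_toReal.congr ?_).aestronglyMeasurable
    filter_upwards [hX, hXU] with ω h1 h2
    rw [← h2, ENNReal.toReal_ofReal h1]
  have e : ∫⁻ ω, ENNReal.ofReal (X ω) ∂P = ∫⁻ ω, U ω ∂P := lintegral_congr_ae hXU
  refine ⟨?_, by rw [integral_eq_lintegral_of_nonneg_ae hX hXm, e]⟩
  refine ⟨hXm, ?_⟩
  rw [hasFiniteIntegral_iff_ofReal hX, e]
  exact hfin.lt_top

lemma memLp_two_of_ofReal_ae_eq {X : Ω → ℝ} {U : Ω → ℝ≥0∞} (hX : 0 ≤ᵐ[P] X)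
    (hU : AEMeasurable U P) (hXU : ∀ᵐ ω ∂P, ENNReal.ofReal (X ω) = U ω)
    (hfin : ∫⁻ ω, U ω ^ 2 ∂P ≠ ∞) :
    MemLp X 2 P ∧ ∫ ω, X ω ^ 2 ∂P = (∫⁻ ω, U ω ^ 2 ∂P).toReal := by
  have h := integral_eq_of_ofReal_ae_eq (X := fun ω => X ω ^ 2) (.of_forall fun ω => sq_nonneg _)
    (hU.pow_const 2) (by
      filter_upwards [hX, hXU] with ω h1 h2
      rw [ENNReal.ofReal_pow h1, h2]) hfin
  have hXm : AEStronglyMeasurable X P := by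
    refine (hU.ennreal_toReal.congr ?_).aestronglyMeasurable
    filter_upwards [hX, hXU] with ω h1 h2
    rw [← h2, ENNReal.toReal_ofReal h1]
  exact ⟨(memLp_two_iff_integrable_sq hXm).2 h.1, h.2⟩

end RealValued

section TimeMeasure

variable {T : ℝ}

instance isFiniteMeasure_timeMeasure : IsFiniteMeasure (timeMeasure T) := by
  refine ⟨?_⟩
  rw [timeMeasure, (MeasurableEmbedding.subtype_coe measurableSet_Icc).comap_apply]
  refine (measure_mono (t := Icc 0 T) ?_).trans_lt (by simp)
  rintro _ ⟨x, -, rfl⟩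
  exact x.2

instance nullSingletonClass_timeMeasure : NullSingletonClass (timeMeasure T) := by
  refine ⟨fun x => ?_⟩
  rw [timeMeasure, (MeasurableEmbedding.subtype_coe measurableSet_Icc).comap_apply]
  simp

end TimeMeasure

/-! ### Regular versions and square integrability of the intensity -/

section Regularization

variable {Ω : Type*} {m mΩ : MeasurableSpace Ω} {P : Measure Ω}

lemma measurable_of_ae_eq {β : Type*} [MeasurableSpace β]
    (hnull : ∀ A : Set Ω, P A = 0 → MeasurableSet[m] A) {f g : Ω → β} (hf : Measurable[m] f)
    (hfg : g =ᵐ[P] f) : Measurable[m] g :=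
  (hf.eventuallyMeasurable_of_eventuallyEq hfg).mono
    (eventuallyMeasurableSpace_le le_rfl hnull) le_rfl

lemma measurableSet_eventuallyMeasurableSpace_of_null (A : Set Ω) (hA : P A = 0) :
    MeasurableSet[eventuallyMeasurableSpace m (ae P)] A :=
  ⟨∅, @MeasurableSet.empty Ω m, ae_eq_empty.2 hA⟩

/-- A family of random variables almost all of whose paths lie in a class `C` is modified on the
exceptional set so that all paths do. -/
lemma exists_forall_paths {ι β : Type*} (C : Set (ι → β)) (hC : C.Nonempty) (X : ι → Ω → β)
    (hX : ∀ᵐ ω ∂P, (fun t => X t ω) ∈ C) :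
    ∃ X' : ι → Ω → β, (∀ ω, (fun t => X' t ω) ∈ C) ∧ ∀ᵐ ω ∂P, ∀ t, X' t ω = X t ω := by
  classical
  obtain ⟨x₀, hx₀⟩ := hC
  refine ⟨fun t ω => if (fun t => X t ω) ∈ C then X t ω else x₀ t, fun ω => ?_, ?_⟩
  · by_cases h : (fun t => X t ω) ∈ C
    · simp [h]
    · simpa [h] using hx₀
  · filter_upwards [hX] with ω hω t
    simp [hω]

lemma predictable_le_prod {ι : Type*} [LinearOrder ι] [OrderBot ι] [OrderTop ι]
    [TopologicalSpace ι] [OrderClosedTopology ι] [MeasurableSpace ι] [OpensMeasurableSpace ι]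
    (𝓖 : Filtration ι mΩ) : 𝓖.predictable ≤ Prod.instMeasurableSpace (m₂ := 𝓖 ⊤) :=
  measurableSpace_le_predictable_of_measurableSet
    (fun _ hA => MeasurableSet.prod (measurableSet_singleton _) (𝓖.mono bot_le _ hA))
    (fun _ _ hA => MeasurableSet.prod measurableSet_Ioi (𝓖.mono le_top _ hA))

end Regularization

/-- An exponential moment conditional on an independent σ-algebra bounds the second moment. -/
lemma lintegral_sq_ne_top_of_condLExp_exp {Ω : Type*} {m m' mΩ : MeasurableSpace Ω}
    {P : Measure Ω} [IsProbabilityMeasure P] (hm : m ≤ mΩ) (hm' : m' ≤ mΩ)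
    (hind : Indep m m' P) {Λ : Ω → ℝ≥0∞} (hΛ : Measurable[m'] Λ) (hΛfin : ∀ᵐ ω ∂P, Λ ω ≠ ∞)
    {c : ℝ} (hc : 0 < c)
    (h : ∀ᵐ ω ∂P, condLExp m P (fun ω => ENNReal.ofReal (Real.exp (c * (Λ ω).toReal))) ω < ∞) :
    ∫⁻ ω, Λ ω ^ 2 ∂P ≠ ∞ := by
  have hF : Measurable[m'] fun ω => ENNReal.ofReal (Real.exp (c * (Λ ω).toReal)) :=
    (Real.measurable_exp.comp (hΛ.ennreal_toReal.const_mul c)).ennreal_ofReal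
  have hfin := lintegral_ne_top_of_condLExp_lt_top hm hm' hF hind h
  have hle : ∫⁻ ω, Λ ω ^ 2 ∂P ≤ ∫⁻ ω, ENNReal.ofReal (2 / c ^ 2) *
      ENNReal.ofReal (Real.exp (c * (Λ ω).toReal)) ∂P := by
    refine lintegral_mono_ae ?_
    filter_upwards [hΛfin] with ω hω
    have h0 : 0 ≤ (Λ ω).toReal := ENNReal.toReal_nonneg
    have h1 := Real.quadratic_le_exp_of_nonneg (mul_nonneg hc.le h0)
    rw [← ENNReal.ofReal_toReal hω, ← ENNReal.ofReal_pow h0,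
      ← ENNReal.ofReal_mul (by positivity), ENNReal.toReal_ofReal h0]
    refine ENNReal.ofReal_le_ofReal ?_
    have h2 : (c * (Λ ω).toReal) ^ 2 / 2 ≤ Real.exp (c * (Λ ω).toReal) := by
      have := mul_nonneg hc.le h0
      linarith
    calc (Λ ω).toReal ^ 2 = 2 / c ^ 2 * ((c * (Λ ω).toReal) ^ 2 / 2) := by field_simp
      _ ≤ 2 / c ^ 2 * Real.exp (c * (Λ ω).toReal) := by gcongr
  refine ne_top_of_le_ne_top ?_ hle
  rw [lintegral_const_mul _ (hF.mono hm' le_rfl)]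
  exact ENNReal.mul_ne_top ENNReal.ofReal_ne_top hfin

section Claims

variable {Ω : Type*} {mΩ : MeasurableSpace Ω} {P : Measure Ω} {T : ℝ}

lemma IsClaimSequence.ae_pos {Y : Icc (0 : ℝ) T → Ω → ℝ} {N : Icc (0 : ℝ) T → Ω → ℕ}
    {ζ : ℕ → Ω → ℝ} {Z : Ω → ℝ} (hZ : IsClaimSequence P Y N ζ Z) : ∀ᵐ ω ∂P, 0 < Z ω :=
  (hZ.identDistrib 0).ae_snd (p := fun x => 0 < x) measurableSet_Ioi (hZ.positive 0)

/-- Positive claims have an exponential moment strictly larger than `1`. -/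
lemma one_lt_integral_exp_of_pos [IsProbabilityMeasure P] {X : Ω → ℝ}
    (hX : ∀ᵐ ω ∂P, 0 < X ω) (hint : Integrable (fun ω => Real.exp (X ω)) P) :
    1 < ∫ ω, Real.exp (X ω) ∂P := by
  have hpos : 0 < ∫ ω, (Real.exp (X ω) - 1) ∂P := by
    have hnn : 0 ≤ᵐ[P] fun ω => Real.exp (X ω) - 1 := by
      filter_upwards [hX] with ω hω
      simpa using hω.le
    rw [integral_pos_iff_support_of_nonneg_ae hnn (hint.sub (integrable_const 1))]
    have : P (Function.support fun ω => Real.exp (X ω) - 1) = 1 := by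
      have hsupp : ∀ᵐ ω ∂P, ω ∈ Function.support fun ω => Real.exp (X ω) - 1 := by
        filter_upwards [hX] with ω hω
        simpa [sub_eq_zero] using hω.ne'
      exact (measure_congr (eventuallyEq_univ.2 hsupp)).trans measure_univ
    rw [this]
    exact one_pos
  rw [integral_sub hint (integrable_const 1)] at hpos
  simpa using hpos

end Claims

section Intensity

variable {Ω : Type*} {m mΩ : MeasurableSpace Ω} {P : Measure Ω} {T : ℝ}

lemma measurable_uncurry_intensity {lam : Icc (0 : ℝ) T → ℝ → ℝ}
    (hlam : Measurable (Function.uncurry lam)) {Y : Icc (0 : ℝ) T → Ω → ℝ}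
    (hY : ∀ t, Measurable[m] (Y t)) (hYc : ∀ ω, Continuous fun t => Y t ω) :
    Measurable[Prod.instMeasurableSpace (m₂ := m)]
      (Function.uncurry fun s ω => ENNReal.ofReal (lam s (Y s ω))) := by
  have h : Measurable[Prod.instMeasurableSpace (m₂ := m)] (Function.uncurry Y) :=
    measurable_uncurry_of_continuous_of_measurable hYc hY
  exact (hlam.comp (measurable_fst.prodMk h)).ennreal_ofReal

/-- Bochner integrals against a nonnegative intensity, as integrals in `[0, ∞]`. -/
lemma setIntegral_intensity_eq_toReal {lam : Icc (0 : ℝ) T → ℝ → ℝ}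
    (hlam : Measurable (Function.uncurry lam)) (hlam_pos : ∀ t y, 0 < lam t y)
    {w y : Icc (0 : ℝ) T → ℝ} (hw : Measurable w) (hw0 : ∀ s, 0 ≤ w s) (hy : Continuous y)
    (A : Set (Icc (0 : ℝ) T)) :
    ∫ s in A, w s * lam s (y s) ∂(timeMeasure T) =
      (∫⁻ s in A, ENNReal.ofReal (w s) * ENNReal.ofReal (lam s (y s)) ∂(timeMeasure T)).toReal := by
  rw [integral_eq_lintegral_of_nonneg_ae
    (.of_forall fun s => mul_nonneg (hw0 s) (hlam_pos s _).le)
    (hw.mul (hlam.comp (measurable_id.prodMk hy.measurable))).aestronglyMeasurable]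
  simp_rw [ENNReal.ofReal_mul (hw0 _)]

/-- The integrated intensity over `[0, T]` is square integrable. Being a functional of the
factor, it is known from the Brownian motion, hence independent of the initial σ-algebra, so the
conditional exponential moment at time `0` is an unconditional one. -/
lemma lintegral_sq_intensity_ne_top [IsProbabilityMeasure P] [Fact (0 ≤ T)]
    {𝓕 : Filtration (Icc (0 : ℝ) T) mΩ} (h𝓕 : UsualConditions 𝓕 P)
    {W : Icc (0 : ℝ) T → Ω → ℝ} (hW : IsBrownianMotion 𝓕 P W) {Y Y' : Icc (0 : ℝ) T → Ω → ℝ}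
    (hY : ∀ t, Measurable[augmentedHistory P W t] (Y t))
    (hYc : ∀ ω, Continuous fun t => Y' t ω) (hYY' : ∀ᵐ ω ∂P, ∀ t, Y' t ω = Y t ω)
    {lam : Icc (0 : ℝ) T → ℝ → ℝ}
    (hlam : Measurable (Function.uncurry lam)) (hlam_pos : ∀ t y, 0 < lam t y)
    (hfin : ∫⁻ ω, ∫⁻ s, ENNReal.ofReal (lam s (Y' s ω)) ∂(timeMeasure T) ∂P ≠ ∞)
    {c : ℝ} (hc : 0 < c)
    (hexp : ∀ᵐ ω ∂P, condLExp (𝓕 ⊥) P (fun ω' => ENNReal.ofReal (Real.exp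
      (c * ∫ s in Ioc ⊥ ⊤, lam s (Y s ω') ∂(timeMeasure T)))) ω < ∞) :
    ∫⁻ ω, (∫⁻ s, ENNReal.ofReal (lam s (Y' s ω)) ∂(timeMeasure T)) ^ 2 ∂P ≠ ∞ := by
  have hm' : augmentedHistory P W ⊤ ≤ mΩ := by
    refine sup_le (iSup₂_le fun s _ => (hW.measurable s).comap_le)
      (MeasurableSpace.generateFrom_le fun A hA => ?_)
    exact 𝓕.le ⊥ _ (h𝓕.complete A hA)
  have hnull : ∀ A : Set Ω, P A = 0 → MeasurableSet[augmentedHistory P W ⊤] A := fun A hA =>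
    (le_sup_right : _ ≤ augmentedHistory P W ⊤) _ (MeasurableSpace.measurableSet_generateFrom hA)
  have hmono : ∀ t, augmentedHistory P W t ≤ augmentedHistory P W ⊤ := fun t =>
    by
    refine sup_le_sup_right (biSup_mono fun s (_ : s ≤ t) => ?_) _
    exact le_top (a := s)
  have hY' : ∀ t, Measurable[augmentedHistory P W ⊤] (Y' t) := fun t =>
    measurable_of_ae_eq hnull ((hY t).mono (hmono t) le_rfl)
      (by filter_upwards [hYY'] with ω hω using hω t)
  have hℓ := measurable_uncurry_intensity hlam hY' hYc
  have hΛ : Measurable[augmentedHistory P W ⊤] fun ω =>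
      ∫⁻ s, ENNReal.ofReal (lam s (Y' s ω)) ∂(timeMeasure T) := by
    simpa using measurable_setLIntegral_left (ν := timeMeasure T) hℓ univ
  have hΛfin : ∀ᵐ ω ∂P, ∫⁻ s, ENNReal.ofReal (lam s (Y' s ω)) ∂(timeMeasure T) ≠ ∞ := by
    filter_upwards [ae_lt_top (hΛ.mono hm' le_rfl) hfin] with ω hω using hω.ne
  refine lintegral_sq_ne_top_of_condLExp_exp (𝓕.le ⊥) hm' (hW.indep_augmentedHistory ⊤) hΛ
    hΛfin hc ?_
  refine Eventually.congr hexp ?_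
  have hcongr : (fun ω => ENNReal.ofReal (Real.exp
      (c * ∫ s in Ioc ⊥ ⊤, lam s (Y s ω) ∂(timeMeasure T)))) =ᵐ[P] fun ω =>
      ENNReal.ofReal (Real.exp
        (c * (∫⁻ s, ENNReal.ofReal (lam s (Y' s ω)) ∂(timeMeasure T)).toReal)) := by
    filter_upwards [hYY'] with ω hω
    have h := setIntegral_intensity_eq_toReal hlam hlam_pos (w := fun _ => 1) measurable_const
      (fun _ => zero_le_one) (hYc ω) (Ioc ⊥ ⊤)
    rw [← setLIntegral_Iic_eq_Ioc_bot] at h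
    simp only [one_mul, ENNReal.ofReal_one, Iic_top, Measure.restrict_univ] at h
    simp_rw [← h, hω]
  filter_upwards [condLExp_congr_ae hcongr (mΩ := 𝓕 ⊥)] with ω hω
  rw [hω]

end Intensity

/-! ### Variance of the ceded claims -/

section Variance

variable {Ω : Type*} {mΩ : MeasurableSpace Ω} {P : Measure Ω} {T : ℝ}

/-- The σ-algebra generated by the whole path of the factor, completed by null sets. -/
abbrev factorHistory (P : Measure Ω) (Y : Icc (0 : ℝ) T → Ω → ℝ) : MeasurableSpace Ω :=
  eventuallyMeasurableSpace (⨆ t, MeasurableSpace.comap (Y t) inferInstance) (ae P)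

/-- The σ-algebra generated by the arrivals and the factor, completed by null sets. -/
abbrev arrivalFactorHistory (P : Measure Ω) (N : Icc (0 : ℝ) T → Ω → ℕ)
    (Y : Icc (0 : ℝ) T → Ω → ℝ) : MeasurableSpace Ω :=
  eventuallyMeasurableSpace ((⨆ t, MeasurableSpace.comap (N t) inferInstance) ⊔
    ⨆ t, MeasurableSpace.comap (Y t) inferInstance) (ae P)

/-- The past of the filtration up to a given time, enlarged by the whole path of the factor. -/
abbrev enlargedPast [Fact (0 ≤ T)] (𝓕 : Filtration (Icc (0 : ℝ) T) mΩ)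
    (Y : Icc (0 : ℝ) T → Ω → ℝ) (hY : ∀ t, Measurable (Y t)) (s : Icc (0 : ℝ) T) :
    MeasurableSpace Ω :=
  generatedFiltration Y hY ⊤ ⊔ 𝓕 s

lemma generatedFiltration_top [Fact (0 ≤ T)] (Y : Icc (0 : ℝ) T → Ω → ℝ)
    (hY : ∀ t, Measurable (Y t)) :
    generatedFiltration Y hY ⊤ = ⨆ t, MeasurableSpace.comap (Y t) inferInstance := by
  change (⨆ t ≤ (⊤ : Icc (0 : ℝ) T), MeasurableSpace.comap (Y t) _) = _
  simp only [le_top, iSup_pos]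

/-- Regular versions of the factor and of the arrivals: both agree with the given processes off a
null set, and all their paths have the properties that the given ones have almost surely. -/
lemma exists_regular_versions [Fact (0 ≤ T)] {Y : Icc (0 : ℝ) T → Ω → ℝ}
    {N : Icc (0 : ℝ) T → Ω → ℕ} (hY : ∀ᵐ ω ∂P, Continuous fun t => Y t ω)
    (hN0 : ∀ᵐ ω ∂P, N ⊥ ω = 0) (hNm : ∀ᵐ ω ∂P, Monotone fun t => N t ω)
    (hNc : ∀ᵐ ω ∂P, ∀ t, ContinuousWithinAt (fun r => N r ω) (Ici t) t) :
    ∃ (Y' : Icc (0 : ℝ) T → Ω → ℝ) (N' : Icc (0 : ℝ) T → Ω → ℕ),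
      (∀ᵐ ω ∂P, ∀ t, Y' t ω = Y t ω) ∧ (∀ᵐ ω ∂P, ∀ t, N' t ω = N t ω) ∧
      (∀ ω, Continuous fun t => Y' t ω) ∧ (∀ ω, N' ⊥ ω = 0) ∧
      (∀ ω, Monotone fun t => N' t ω) ∧
      ∀ ω t, ContinuousWithinAt (fun r => N' r ω) (Ici t) t := by
  obtain ⟨Y', hY'c, hY'⟩ := exists_forall_paths (P := P)
    {y : Icc (0 : ℝ) T → ℝ | Continuous y} ⟨fun _ => 0, continuous_const⟩ Y hY
  obtain ⟨N', hN'c, hN'⟩ := exists_forall_paths (P := P)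
    {n : Icc (0 : ℝ) T → ℕ | n ⊥ = 0 ∧ Monotone n ∧ ∀ t, ContinuousWithinAt n (Ici t) t}
    ⟨fun _ => 0, rfl, monotone_const, fun _ => continuousWithinAt_const⟩ N
    (by filter_upwards [hN0, hNm, hNc] with ω h1 h2 h3 using ⟨h1, h2, h3⟩)
  exact ⟨Y', N', hY', hN', hY'c, fun ω => (hN'c ω).1, fun ω => (hN'c ω).2.1,
    fun ω => (hN'c ω).2.2⟩

/-- On a path with nonnegative claims the integral against the claims process is the sum over the
jump times, written as a series in `[0, ∞]`. -/
lemma ofReal_setIntegral_claims [Fact (0 ≤ T)] {n : Icc (0 : ℝ) T → ℕ} (hn : Monotone n)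
    (hc : ∀ t, ContinuousWithinAt n (Ici t) t) (hn0 : n ⊥ = 0) {ζ : ℕ → ℝ} (hζ : ∀ i, 0 ≤ ζ i)
    {u : Icc (0 : ℝ) T → ℝ} (hu : ∀ s, 0 ≤ u s) (t : Icc (0 : ℝ) T) :
    0 ≤ ∫ s in Iic t, u s ∂(stieltjesMeasure fun t => ∑ i ∈ Finset.range (n t), ζ i) ∧
    ENNReal.ofReal
        (∫ s in Iic t, u s ∂(stieltjesMeasure fun t => ∑ i ∈ Finset.range (n t), ζ i)) =
      ∑' i, (if i < n t then ENNReal.ofReal (u (jumpTime n i)) else 0) *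
        ENNReal.ofReal (ζ i) := by
  rw [setIntegral_stieltjesMeasure_sum_range hn hc hn0 hζ]
  refine ⟨Finset.sum_nonneg fun i _ => mul_nonneg (hu _) (hζ i), ?_⟩
  rw [ENNReal.ofReal_sum_of_nonneg fun i _ => mul_nonneg (hu _) (hζ i),
    tsum_eq_sum (s := Finset.range (n t)) fun i hi => by
      rw [if_neg (by simpa using hi), zero_mul]]
  refine Finset.sum_congr rfl fun i hi => ?_
  rw [if_pos (Finset.mem_range.1 hi), ENNReal.ofReal_mul (hu _)]

end Variance

end StochasticFactorModel

end

open StochasticFactorModel in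
theorem mainTheorem6
    {Ω : Type*} {mΩ : MeasurableSpace Ω} (P : Measure Ω) [IsProbabilityMeasure P]
    (T : ℝ) [Fact (0 ≤ T)] (𝓕 : Filtration (Set.Icc (0 : ℝ) T) mΩ)
    (h𝓕 : StochasticFactorModel.UsualConditions 𝓕 P)
    -- the stochastic factor
    (W : Set.Icc (0 : ℝ) T → Ω → ℝ) (hW : StochasticFactorModel.IsBrownianMotion 𝓕 P W)
    (b γ : Set.Icc (0 : ℝ) T → ℝ → ℝ) (hb : Measurable (Function.uncurry b))
    (hγ : Measurable (Function.uncurry γ)) (y₀ : ℝ)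
    (Y : Set.Icc (0 : ℝ) T → Ω → ℝ) (hYm : ∀ t, Measurable (Y t))
    (hY : StochasticFactorModel.IsStrongSolution 𝓕 P W b γ y₀ Y)
    -- the intensity
    (lam : Set.Icc (0 : ℝ) T → ℝ → ℝ) (hlam : Measurable (Function.uncurry lam))
    (hlam_pos : ∀ t y, 0 < lam t y)
    (hlam_int : ∫⁻ ω, ∫⁻ s, ENNReal.ofReal (lam s (Y s ω))
      ∂(StochasticFactorModel.timeMeasure T) ∂P < ⊤)
    -- the claim arrivals and the claim sizes
    (N : Set.Icc (0 : ℝ) T → Ω → ℕ)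
    (hN : StochasticFactorModel.IsConditionalPoisson 𝓕 P Y hYm (fun s ω => lam s (Y s ω)) N)
    (ζ : ℕ → Ω → ℝ) (Z : Ω → ℝ) (hZ : StochasticFactorModel.IsClaimSequence P Y N ζ Z)
    (η R : ℝ) (hη : 0 < η) (hR : 0 < R)
    (hexp : StochasticFactorModel.ExponentialIntegrability 𝓕 P η R Z
      (fun s ω => lam s (Y s ω)))
    -- the reinsurance strategy
    (u : Set.Icc (0 : ℝ) T → Ω → ℝ)
    (hu : IsStronglyPredictable (StochasticFactorModel.generatedFiltration Y hYm) u)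
    (hu01 : ∀ t ω, u t ω ∈ Set.Icc (0 : ℝ) 1)
    (t : Set.Icc (0 : ℝ) T) :
    MemLp (StochasticFactorModel.pathIntegral u
      (StochasticFactorModel.cumulativeClaims N ζ) t) 2 P ∧
    MemLp Z 2 P ∧
    Integrable (fun ω => ∫ s in Set.Iic t, u s ω ^ 2 * lam s (Y s ω)
      ∂(StochasticFactorModel.timeMeasure T)) P ∧
    MemLp (fun ω => ∫ s in Set.Iic t, u s ω * lam s (Y s ω)
      ∂(StochasticFactorModel.timeMeasure T)) 2 P ∧
    variance (StochasticFactorModel.pathIntegral u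
        (StochasticFactorModel.cumulativeClaims N ζ) t) P =
      (∫ ω, Z ω ^ 2 ∂P) *
          (∫ ω, ∫ s in Set.Iic t, u s ω ^ 2 * lam s (Y s ω)
            ∂(StochasticFactorModel.timeMeasure T) ∂P) +
        (∫ ω, Z ω ∂P) ^ 2 *
          variance (fun ω => ∫ s in Set.Iic t, u s ω * lam s (Y s ω)
            ∂(StochasticFactorModel.timeMeasure T)) P := by
  classical
  -- regular versions of the paths
  obtain ⟨Y', N', hY', hN', hY'c, hN'0, hN'm, hN'c⟩ := exists_regular_versions (P := P)
    hY.continuous_paths hN.initial hN.monotone_paths hN.rightContinuous_paths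
  have hnullF : ∀ A : Set Ω, P A = 0 → MeasurableSet A := fun A hA =>
    𝓕.le ⊥ _ (h𝓕.complete A hA)
  have hNm : ∀ t, Measurable (N t) := fun t => (hN.adapted t).mono (𝓕.le t) le_rfl
  have hsY : (⨆ t, MeasurableSpace.comap (Y t) inferInstance) ≤ mΩ :=
    iSup_le fun t => (hYm t).comap_le
  have hG : ∀ s, enlargedPast 𝓕 Y hYm s ≤ mΩ := fun s =>
    sup_le ((generatedFiltration Y hYm).le ⊤) (𝓕.le s)
  have hGmono : Monotone (enlargedPast 𝓕 Y hYm) := fun s s' hs => sup_le_sup_left (𝓕.mono hs) _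
  have hGnull : ∀ s, ∀ A : Set Ω, P A = 0 → MeasurableSet[enlargedPast 𝓕 Y hYm s] A :=
    fun s A hA => (le_sup_right : 𝓕 s ≤ enlargedPast 𝓕 Y hYm s) _
      (𝓕.mono bot_le _ (h𝓕.complete A hA))
  have hmG : factorHistory P Y ≤ enlargedPast 𝓕 Y hYm ⊥ :=
    eventuallyMeasurableSpace_le (le_sup_of_le_left (generatedFiltration_top Y hYm).ge)
      (hGnull ⊥)
  have hm' : arrivalFactorHistory P N Y ≤ mΩ :=
    eventuallyMeasurableSpace_le (sup_le (iSup_le fun t => (hNm t).comap_le) hsY) hnullF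
  have hmm' : factorHistory P Y ≤ arrivalFactorHistory P N Y :=
    eventuallyMeasurableSpace_le (le_sup_right.trans le_eventuallyMeasurableSpace)
      measurableSet_eventuallyMeasurableSpace_of_null
  have hY't : ∀ t, Y' t =ᵐ[P] Y t := fun t => by filter_upwards [hY'] with ω hω using hω t
  have hN't : ∀ t, N' t =ᵐ[P] N t := fun t => by filter_upwards [hN'] with ω hω using hω t
  have hY'm : ∀ t, Measurable[factorHistory P Y] (Y' t) := fun t =>
    (measurable_iff_comap_le.2 (le_iSup (fun t => MeasurableSpace.comap (Y t) inferInstance)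
      t)).eventuallyMeasurable_of_eventuallyEq (hY't t)
  have hN'G : ∀ t, Measurable[enlargedPast 𝓕 Y hYm t] (N' t) := fun t =>
    measurable_of_ae_eq (hGnull t) ((hN.adapted t).mono le_sup_right le_rfl) (hN't t)
  have hN'm' : ∀ t, Measurable[arrivalFactorHistory P N Y] (N' t) := fun t => by
    refine Measurable.eventuallyMeasurable_of_eventuallyEq ?_ (hN't t)
    rw [measurable_iff_comap_le]
    exact le_sup_of_le_left (le_iSup (fun t => MeasurableSpace.comap (N t) inferInstance) t)
  -- the intensity and the strategy as `[0, ∞]`-valued processes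
  set ℓ : Icc (0 : ℝ) T → Ω → ℝ≥0∞ := fun s ω => ENNReal.ofReal (lam s (Y' s ω))
  set v : Icc (0 : ℝ) T → Ω → ℝ≥0∞ := fun s ω => ENNReal.ofReal (u s ω)
  have hℓ : Measurable[Prod.instMeasurableSpace (m₂ := factorHistory P Y)] (Function.uncurry ℓ) :=
    measurable_uncurry_intensity hlam hY'm hY'c
  have hu' : Measurable[Prod.instMeasurableSpace (m₂ := factorHistory P Y)] (Function.uncurry u) := by
    refine hu.measurable.mono ((predictable_le_prod _).trans ?_) le_rfl
    rw [generatedFiltration_top]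
    exact sup_le_sup_left (MeasurableSpace.comap_mono le_eventuallyMeasurableSpace) _
  have hv : Measurable[Prod.instMeasurableSpace (m₂ := factorHistory P Y)] (Function.uncurry v) :=
    hu'.ennreal_ofReal
  have hv1 : ∀ s ω, v s ω ≤ 1 := fun s ω => by
    simpa [v] using (hu01 s ω).2
  have hus : ∀ ω, Measurable fun s => u s ω := fun ω => hu'.comp measurable_prodMk_right
  -- integrability of the intensity
  have hfin : ∫⁻ ω, ∫⁻ s, ℓ s ω ∂(timeMeasure T) ∂P ≠ ⊤ := by
    have : ∫⁻ ω, ∫⁻ s, ℓ s ω ∂(timeMeasure T) ∂P =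
        ∫⁻ ω, ∫⁻ s, ENNReal.ofReal (lam s (Y s ω)) ∂(timeMeasure T) ∂P := by
      refine lintegral_congr_ae ?_
      filter_upwards [hY'] with ω hω
      simp only [ℓ, hω]
    rw [this]
    exact hlam_int.ne
  have hZpos : ∀ᵐ ω ∂P, 0 < Z ω := hZ.ae_pos
  -- the factor in front of the integrated intensity in the exponential moment
  have hc : 0 < (∫ ω, Real.exp (η * Real.exp (R * T) * Z ω) ∂P) - 1 := by
    refine sub_pos.2 (one_lt_integral_exp_of_pos ?_ ?_)
    · filter_upwards [hZpos] with ω hω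
      positivity
    · refine hexp.exp_claim.congr (.of_forall fun ω => ?_)
      simp only
      congr 1
      ring
  have hfin2 : ∫⁻ ω, (∫⁻ s, ℓ s ω ∂(timeMeasure T)) ^ 2 ∂P ≠ ⊤ :=
    lintegral_sq_intensity_ne_top h𝓕 hW hY.adapted hY'c hY' hlam hlam_pos hfin hc
      (hexp.exp_intensity ⊥)
  -- the conditional law of the regular version
  have hlaw : ∀ s t, s ≤ t → HasConditionalPoissonLaw P (enlargedPast 𝓕 Y hYm s) (fun ω => N' t ω - N' s ω)
      fun ω => (∫⁻ r in Ioc s t, ℓ r ω ∂(timeMeasure T)).toReal := by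
    intro s t hst k
    have hset : {ω | N' t ω - N' s ω = k}.indicator (fun _ => (1 : ℝ)) =ᵐ[P]
        {ω | N t ω = N s ω + k}.indicator (fun _ => (1 : ℝ)) := by
      filter_upwards [hN'] with ω hω
      have h := hN'm ω hst
      simp only [hω] at h
      have : (N' t ω - N' s ω = k) ↔ (N t ω = N s ω + k) := by
        rw [hω, hω]
        omega
      simp only [indicator, mem_ofPred_eq, this]
    refine (condExp_congr_ae hset).trans ((hN.conditional_law s t hst k).trans ?_)
    filter_upwards [hY'] with ω hω
    have h := setIntegral_intensity_eq_toReal hlam hlam_pos (w := fun _ => 1) measurable_const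
      (fun _ => zero_le_one) (hY'c ω) (Ioc s t)
    simp only [one_mul, ENNReal.ofReal_one, hω] at h
    simp only [ℓ, hω, h]
  -- the claims
  set z : ℕ → Ω → ℝ≥0∞ := fun i ω => ENNReal.ofReal (ζ i ω)
  have hz : ∀ i, Measurable (z i) := fun i => (hZ.measurable i).ennreal_ofReal
  have hind : Indep (⨆ i, MeasurableSpace.comap (z i) inferInstance)
      (arrivalFactorHistory P N Y) P := by
    refine indep_eventuallyMeasurableSpace_right
      (indep_of_indep_of_le_left hZ.indep_arrivals_factor (iSup_mono fun i => ?_))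
    exact (ENNReal.measurable_ofReal.comp (comap_measurable (ζ i))).comap_le
  have hiind : Pairwise fun i j => IndepFun (z i) (z j) P := fun i j hij =>
    (hZ.iIndep.indepFun hij).comp ENNReal.measurable_ofReal ENNReal.measurable_ofReal
  have h1 : ∀ i, ∫⁻ ω, z i ω ∂P = ∫⁻ ω, ENNReal.ofReal (Z ω) ∂P := fun i =>
    ((hZ.identDistrib i).comp ENNReal.measurable_ofReal).lintegral_eq
  have h2 : ∀ i, ∫⁻ ω, z i ω ^ 2 ∂P = ∫⁻ ω, ENNReal.ofReal (Z ω) ^ 2 ∂P := fun i =>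
    ((hZ.identDistrib i).comp (ENNReal.measurable_ofReal.pow_const 2)).lintegral_eq
  have hZm : AEMeasurable Z P := (hZ.identDistrib 0).aemeasurable_snd
  have hZ2 : ∫⁻ ω, ENNReal.ofReal (Z ω) ^ 2 ∂P ≠ ⊤ := by
    have hle : ∫⁻ ω, ENNReal.ofReal (Z ω) ^ 2 ∂P ≤
        ∫⁻ ω, ENNReal.ofReal (Z ω ^ 2 * Real.exp (η * Z ω * Real.exp (R * T))) ∂P := by
      refine lintegral_mono_ae ?_
      filter_upwards [hZpos] with ω hω
      rw [← ENNReal.ofReal_pow hω.le]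
      refine ENNReal.ofReal_le_ofReal (le_mul_of_one_le_right (sq_nonneg _) ?_)
      exact Real.one_le_exp (by positivity)
    exact ne_top_of_le_ne_top hexp.sq_mul_exp_claim.lintegral_lt_top.ne hle
  obtain ⟨hZL, hZsq⟩ := memLp_two_of_ofReal_ae_eq (X := Z) (U := fun ω => ENNReal.ofReal (Z ω))
    (by filter_upwards [hZpos] with ω hω using hω.le) hZm.ennreal_ofReal (.of_forall fun _ => rfl)
    hZ2
  have hZ1 : ∫⁻ ω, ENNReal.ofReal (Z ω) ∂P ≠ ⊤ :=
    (hZL.integrable one_le_two).lintegral_lt_top.ne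
  obtain ⟨-, hZmean⟩ := integral_eq_of_ofReal_ae_eq (X := Z) (U := fun ω => ENNReal.ofReal (Z ω))
    (by filter_upwards [hZpos] with ω hω using hω.le) hZm.ennreal_ofReal (.of_forall fun _ => rfl)
    hZ1
  -- moments in `[0, ∞]`
  set a : ℕ → Ω → ℝ≥0∞ := fun i =>
    {ω | i < N' t ω}.indicator fun ω => v (jumpTime (fun t => N' t ω) i) ω
  set c₁ := ∫⁻ ω, ENNReal.ofReal (Z ω) ∂P
  set c₂ := ∫⁻ ω, ENNReal.ofReal (Z ω) ^ 2 ∂P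
  obtain ⟨ha, hmean, hsq⟩ := lintegral_compoundCox hG hGmono hmG hm' hmm' hN'G hN'm' hN'0 hN'm
    hN'c hℓ hv hfin hfin2 hlaw hz hind hiind h1 h2 t
  set q := ∫⁻ ω, ∫⁻ s in Iic t, v s ω ^ 2 * ℓ s ω ∂(timeMeasure T) ∂P
  set V : Ω → ℝ≥0∞ := fun ω => ∫⁻ s in Iic t, v s ω * ℓ s ω ∂(timeMeasure T)
  have hm : factorHistory P Y ≤ mΩ := hmG.trans (hG ⊥)
  have hVm : Measurable V := (measurable_setLIntegral_left
    (ℓ := fun s ω => v s ω * ℓ s ω) (Measurable.mul hv hℓ) _).mono hm le_rfl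
  have hQm : Measurable fun ω => ∫⁻ s in Iic t, v s ω ^ 2 * ℓ s ω ∂(timeMeasure T) :=
    (measurable_setLIntegral_left (ℓ := fun s ω => v s ω ^ 2 * ℓ s ω)
      ((Measurable.pow_const hv 2).fun_mul hℓ) _).mono hm le_rfl
  have hVle : ∀ ω, V ω ≤ ∫⁻ s, ℓ s ω ∂(timeMeasure T) := fun ω =>
    (lintegral_mono fun s => mul_le_of_le_one_left' (hv1 s ω)).trans
      (setLIntegral_le_lintegral _ _)
  have hv_fin : ∫⁻ ω, V ω ∂P ≠ ⊤ := ne_top_of_le_ne_top hfin (lintegral_mono hVle)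
  have hv2_fin : ∫⁻ ω, V ω ^ 2 ∂P ≠ ⊤ :=
    ne_top_of_le_ne_top hfin2 (lintegral_mono fun ω => pow_le_pow_left' (hVle ω) 2)
  have hq_fin : q ≠ ⊤ := by
    refine ne_top_of_le_ne_top hfin (lintegral_mono fun ω => ?_)
    exact (lintegral_mono fun s => mul_le_of_le_one_left' (pow_le_one' (hv1 s ω) 2)).trans
      (setLIntegral_le_lintegral _ _)
  have hX2 : ∫⁻ ω, (∑' i, a i ω * z i ω) ^ 2 ∂P = c₂ * q + c₁ ^ 2 * ∫⁻ ω, V ω ^ 2 ∂P := by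
    -- cancel the finite term `c₁ ^ 2 * q`, added to avoid a subtraction in `[0, ∞]`
    have hne : c₁ ^ 2 * q ≠ ⊤ := ENNReal.mul_ne_top (ENNReal.pow_ne_top hZ1) hq_fin
    refine (ENNReal.add_left_inj hne).1 (hsq.trans ?_)
    rw [mul_add, add_assoc]
  have hX2_fin : ∫⁻ ω, (∑' i, a i ω * z i ω) ^ 2 ∂P ≠ ⊤ := by
    rw [hX2]
    exact ENNReal.add_ne_top.2 ⟨ENNReal.mul_ne_top hZ2 hq_fin,
      ENNReal.mul_ne_top (ENNReal.pow_ne_top hZ1) hv2_fin⟩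
  have hX1_fin : ∫⁻ ω, ∑' i, a i ω * z i ω ∂P ≠ ⊤ := by
    rw [hmean]
    exact ENNReal.mul_ne_top hZ1 hv_fin
  -- the real random variables of the statement
  have hXU : ∀ᵐ ω ∂P, 0 ≤ pathIntegral u (cumulativeClaims N ζ) t ω ∧
      ENNReal.ofReal (pathIntegral u (cumulativeClaims N ζ) t ω) = ∑' i, a i ω * z i ω := by
    filter_upwards [hN', ae_all_iff.2 hZ.positive] with ω hω hζ
    have h := ofReal_setIntegral_claims (hN'm ω) (hN'c ω) (hN'0 ω) (fun i => (hζ i).le)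
      (fun s => (hu01 s ω).1) t
    have hpath : pathIntegral u (cumulativeClaims N ζ) t ω = ∫ s in Iic t, u s ω
        ∂(stieltjesMeasure fun t => ∑ i ∈ Finset.range (N' t ω), ζ i ω) := by
      simp only [pathIntegral, cumulativeClaims, hω]
    rw [hpath]
    refine ⟨h.1, h.2.trans (tsum_congr fun i => ?_)⟩
    by_cases hi : i < N' t ω <;> simp [a, z, v, hi]
  have hXm : AEMeasurable (fun ω => ∑' i, a i ω * z i ω) P :=
    (Measurable.tsum fun i => (ha i).fun_mul (hz i)).aemeasurable
  have hX0 := hXU.mono fun ω h => h.1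
  have hXe := hXU.mono fun ω h => h.2
  obtain ⟨hXL, hXsq⟩ := memLp_two_of_ofReal_ae_eq hX0 hXm hXe hX2_fin
  obtain ⟨-, hXmean⟩ := integral_eq_of_ofReal_ae_eq hX0 hXm hXe hX1_fin
  have hVfin : ∀ᵐ ω ∂P, ∫⁻ s, ℓ s ω ∂(timeMeasure T) ≠ ⊤ := by
    have hLm : Measurable fun ω => ∫⁻ s, ℓ s ω ∂(timeMeasure T) := by
      simpa using (measurable_setLIntegral_left (ν := timeMeasure T) hℓ univ).mono hm le_rfl
    filter_upwards [ae_lt_top hLm hfin] with ω hω using hω.ne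
  have hV0 : ∀ᵐ ω ∂P, 0 ≤ ∫ s in Iic t, u s ω * lam s (Y s ω) ∂(timeMeasure T) :=
    .of_forall fun ω => integral_nonneg fun s =>
      mul_nonneg (hu01 s ω).1 (hlam_pos _ _).le
  have hVe : ∀ᵐ ω ∂P, ENNReal.ofReal (∫ s in Iic t, u s ω * lam s (Y s ω) ∂(timeMeasure T)) =
      V ω := by
    filter_upwards [hY', hVfin] with ω hω hfinω
    have h := setIntegral_intensity_eq_toReal hlam hlam_pos (hus ω) (fun s => (hu01 s ω).1)
      (hY'c ω) (Iic t)
    simp only [hω] at h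
    rw [h, ENNReal.ofReal_toReal]
    · simp only [V, v, ℓ, hω]
    · refine ne_top_of_le_ne_top hfinω (le_of_eq_of_le ?_ (hVle ω))
      simp only [V, v, ℓ, hω]
  obtain ⟨hVL, hVsq⟩ := memLp_two_of_ofReal_ae_eq hV0 hVm.aemeasurable hVe hv2_fin
  obtain ⟨-, hVmean⟩ := integral_eq_of_ofReal_ae_eq hV0 hVm.aemeasurable hVe hv_fin
  have hQe : ∀ᵐ ω ∂P, ENNReal.ofReal
      (∫ s in Iic t, u s ω ^ 2 * lam s (Y s ω) ∂(timeMeasure T)) =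
        ∫⁻ s in Iic t, v s ω ^ 2 * ℓ s ω ∂(timeMeasure T) := by
    filter_upwards [hY', hVfin] with ω hω hfinω
    have h := setIntegral_intensity_eq_toReal hlam hlam_pos ((hus ω).pow_const 2)
      (fun s => sq_nonneg (u s ω)) (hY'c ω) (Iic t)
    have hvv : ∀ s, ENNReal.ofReal (u s ω ^ 2) = v s ω ^ 2 := fun s =>
      ENNReal.ofReal_pow (hu01 s ω).1 2
    have hle : ∫⁻ s in Iic t, v s ω ^ 2 * ℓ s ω ∂(timeMeasure T) ≤
        ∫⁻ s, ℓ s ω ∂(timeMeasure T) :=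
      (lintegral_mono fun s => mul_le_of_le_one_left' (pow_le_one' (hv1 s ω) 2)).trans
        (setLIntegral_le_lintegral _ _)
    simp only [hvv] at h
    simp only [← hω]
    rw [h, ENNReal.ofReal_toReal (ne_top_of_le_ne_top hfinω hle)]
  obtain ⟨hQint, hQmean⟩ := integral_eq_of_ofReal_ae_eq
    (.of_forall fun ω => integral_nonneg fun s => mul_nonneg (sq_nonneg _) (hlam_pos _ _).le)
    hQm.aemeasurable hQe hq_fin
  refine ⟨hXL, hZL, hQint, hVL, ?_⟩
  rw [variance_eq_sub hXL, variance_eq_sub hVL]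
  simp only [Pi.pow_apply]
  rw [hXsq, hXmean, hVsq, hVmean, hZsq, hZmean, hQmean, hX2, hmean,
    ENNReal.toReal_add (ENNReal.mul_ne_top hZ2 hq_fin)
      (ENNReal.mul_ne_top (ENNReal.pow_ne_top hZ1) hv2_fin)]
  simp only [ENNReal.toReal_mul, ENNReal.toReal_pow]
  ring
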